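/- **Proposition (4-stage schemes in EES(2,7)).** Let $\mathcal H$ be the Butcher--Connes--Kreimer Hopf algebra: the free commutative $\mathbb R$-algebra on the non-empty non-planar rooted trees $\tau$ (the empty forest $\emptyset$ being the unit), with coproduct $\Delta(\tau)=\tau\otimes\emptyset+\emptyset\otimes\tau+\sum_c P_c(\tau)\otimes R_c(\tau)$, the sum being over the admissible cuts $c$ that are neither empty nor total, and antipode $S(\tau)=\sum_{c}(-1)^{|c|+1}\tau^c$, the sum being over all sets $c$ of edges, where $\tau^c$ is the forest left after removing $c$. Let $\mathrm{Id}^{1/2}$ be the multiplicative square root of $\mathrm{Id}$ for the convolution product $fg=\mu\circ(f\otimes g)\circ\Delta$, let $\bar S(\tau)=(-1)^{|\tau|}S(\tau)$, and put $$\tau^-=\mu\circ(\bar S\otimes\mathrm{Id})\circ\Delta\circ\mathrm{Id}^{1/2}(\tau),\qquad \tau^+=\mu\circ(\mathrm{Id}\otimes(\cdot)^-\circ S)\circ\Delta(\tau).$$ A Runge--Kutta scheme with matrix $(a_{ij})$, weights $(b_i)$ and elementary weights $\psi(\tau)$ (extended multiplicatively to $\mathcal H$) belongs to $\mathrm{EES}(n,m)$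 if it is explicit ($a_{ij}=0$ for $j\ge i$), $\sup\{k\in\mathbb N:\psi(\tau)=1/\tau!\ \text{for all }|\tau|\le k\}=n$ and $\sup\{k\in\mathbb N:\psi(\tau^+)=0\ \text{for all }|\tau|\le k\}=m$, where $\tau$ runs over non-empty trees. A $4$-stage Runge--Kutta scheme belongs to $\mathrm{EES}(2,7)$ if and only if it is explicit and there are $s\in\{\sqrt2,-\sqrt2\}$ and $x\in\mathbb R$ with $x\notin\{1,\ \tfrac12,\ \tfrac{1-s}2,\ \tfrac{2-s}2,\ -\tfrac s2\}$ such that, with $$\alpha=\frac{2x+s}{(2x-1)(-2x-s+1)},\qquad \beta=\frac1{(2x-1)(1-s-2x)(2-s-2x)},$$ one has $$b_1=x,\quad b_2=\tfrac12(2-s)-(1-s)x,\quad b_3=(1-s)(x-1),\quad b_4=\tfrac12(2-s)-x,$$ $$a_{21}=\frac{-2+s(1-2x)}{4(x-1)},\quad a_{31}=\frac{(2x+s-2)(4x+s-2)}{4s(x-1)}\,\alpha,\quad a_{32}=\tfrac12(-1+s)\,\alpha,$$ $$a_{41}=\frac{-40x^4+(80-40s)x^3-(88-60s)x^2+(48-34s)x+7s-10}{2(x-1)(2x+s)}\,\beta,$$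 $$a_{42}=(2-s)\,x(x-1)(4x+s-2)\,\beta,\qquad a_{43}=\frac{(2-s)(x-1)(2x-1)}{(2x+s)(2-s-2x)}.$$ -/

import Mathlib

open scoped TensorProduct

/-! ## Non-planar rooted trees -/

/-- Ordered (planar) rooted trees: a root with a finite list of branches. -/
inductive PlanarTree : Type
  | node : List PlanarTree → PlanarTree

namespace PlanarTree

/-- Two ordered trees are isomorphic as (unordered) rooted trees: the equivalence relation generated
by permuting the branches at the root and by replacing a branch by an isomorphic one. -/
inductive Iso : PlanarTree → PlanarTree → Prop
  | perm {l l' : List PlanarTree} : l.Perm l' → Iso (node l) (node l')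
  | branch {t t' : PlanarTree} (l : List PlanarTree) : Iso t t' → Iso (node (t :: l)) (node (t' :: l))
  | symm {t t' : PlanarTree} : Iso t t' → Iso t' t
  | trans {t t' t'' : PlanarTree} : Iso t t' → Iso t' t'' → Iso t t''

theorem Iso.refl : ∀ t : PlanarTree, Iso t t
  | node l => Iso.perm (List.Perm.refl l)

instance setoid : Setoid PlanarTree :=
  ⟨Iso, Iso.refl, Iso.symm, Iso.trans⟩

end PlanarTree

/-- Non-empty, unlabelled, non-planar rooted trees. -/
def RTree : Type := Quotient PlanarTree.setoid

/-- A forest is a finite multiset of non-empty trees; `0` is the empty forest `∅`. -/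
abbrev Forest : Type := Multiset RTree

namespace PlanarTree

/-- The class of an ordered tree. -/
def toRooted (t : PlanarTree) : RTree := Quotient.mk setoid t

mutual
/-- Recursion on ordered trees by a rule that sees only the multiset of branches. -/
def recurse {X : Type} (g : Multiset (RTree × X) → X) : PlanarTree → X
  | node l => g (recurseList g l)
/-- The branches in a list, each together with its recursive value. -/
def recurseList {X : Type} (g : Multiset (RTree × X) → X) :
    List PlanarTree → Multiset (RTree × X)
  | [] => 0
  | t :: l => (t.toRooted, recurse g t) ::ₘ recurseList g l
end

theorem recurseList_eq {X : Type} (g : Multiset (RTree × X) → X) (l : List PlanarTree) :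
    recurseList g l = ((l.map fun t => (t.toRooted, recurse g t) : List (RTree × X)) :
      Multiset (RTree × X)) := by
  induction l with
  | nil => simp [recurseList]
  | cons t l ih => simp [recurseList, ih]

theorem recurse_iso {X : Type} (g : Multiset (RTree × X) → X) {t t' : PlanarTree}
    (h : Iso t t') : recurse g t = recurse g t' := by
  induction h with
  | perm h =>
    simp only [recurse, recurseList_eq]
    exact congrArg g (Multiset.coe_eq_coe.2 (h.map _))
  | branch l h ih =>
    have e := Quotient.sound (s := setoid) h
    simp only [recurse, recurseList, ih]
    unfold toRooted
    rw [e]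
  | symm _ ih => exact ih.symm
  | trans _ _ ih₁ ih₂ => exact ih₁.trans ih₂

end PlanarTree

namespace RTree

/-- An ordered tree representing a given tree. -/
noncomputable def out (τ : RTree) : PlanarTree := Quotient.out (s := PlanarTree.setoid) τ

theorem toRooted_out (τ : RTree) : (out τ).toRooted = τ := Quotient.out_eq τ

theorem out_toRooted_iso (t : PlanarTree) : PlanarTree.Iso (out t.toRooted) t :=
  Quotient.mk_out (s := PlanarTree.setoid) t

/-- `node {τ₁, …, τₖ} = [τ₁, …, τₖ]`: the trees are joined to a new root. -/
noncomputable def node (F : Forest) : RTree :=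
  (PlanarTree.node (F.toList.map out)).toRooted

/-- Recursion on rooted trees: the value at `[τ₁, …, τₖ]` is computed from the branches and the values
at the branches, see `recurse_node`. -/
def recurse {X : Type} (g : Multiset (RTree × X) → X) (τ : RTree) : X :=
  Quotient.lift (PlanarTree.recurse g) (fun _ _ h => PlanarTree.recurse_iso g h) τ

theorem recurse_node {X : Type} (g : Multiset (RTree × X) → X) (F : Forest) :
    recurse g (node F) = g (F.map fun τ => (τ, recurse g τ)) := by
  have key : ∀ τ : RTree,
      ((out τ).toRooted, PlanarTree.recurse g (out τ)) = (τ, recurse g τ) := by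
    intro τ
    have h : recurse g (out τ).toRooted = PlanarTree.recurse g (out τ) := rfl
    rw [← h, toRooted_out]
  have h1 : recurse g (node F) = PlanarTree.recurse g (PlanarTree.node (F.toList.map out)) := rfl
  have h2 : ((fun t => (t.toRooted, PlanarTree.recurse g t)) ∘ out) =
      fun τ : RTree => (τ, recurse g τ) := funext key
  rw [h1, PlanarTree.recurse, PlanarTree.recurseList_eq, List.map_map, h2,
    ← Multiset.map_coe, Multiset.coe_toList]

/-- Every tree is `[τ₁, …, τₖ]` for some forest. -/
theorem exists_eq_node (τ : RTree) : ∃ F : Forest, τ = node F := by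
  obtain ⟨⟨l⟩, rfl⟩ := Quotient.exists_rep τ
  refine ⟨(l.map PlanarTree.toRooted : List RTree), Quotient.sound (s := PlanarTree.setoid) ?_⟩
  have hl : ∀ l₁ l₂ l₃ : List PlanarTree, List.Forall₂ PlanarTree.Iso l₁ l₂ →
      PlanarTree.Iso (.node (l₁ ++ l₃)) (.node (l₂ ++ l₃)) := by
    intro l₁ l₂ l₃ h
    induction h generalizing l₃ with
    | nil => exact PlanarTree.Iso.refl _
    | @cons a b u v hab _ ih =>
      refine (PlanarTree.Iso.branch (u ++ l₃) hab).trans ?_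
      refine (PlanarTree.Iso.perm (l' := u ++ (b :: l₃)) List.perm_middle.symm).trans ?_
      exact (ih (b :: l₃)).trans (PlanarTree.Iso.perm List.perm_middle)
  have hp : (Multiset.toList (l.map PlanarTree.toRooted : List RTree)).Perm
      (l.map PlanarTree.toRooted) := by
    rw [← Multiset.coe_eq_coe, Multiset.coe_toList]
  have hr : List.Forall₂ PlanarTree.Iso l ((l.map PlanarTree.toRooted).map out) := by
    rw [List.map_map, List.forall₂_map_right_iff, List.forall₂_same]
    exact fun t _ => (out_toRooted_iso t).symm
  have h := hl _ _ [] hr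
  rw [List.append_nil, List.append_nil] at h
  exact h.trans (PlanarTree.Iso.perm (hp.symm.map _))

/-- The branches of a tree. -/
def branches : RTree → Forest := recurse fun B => B.map Prod.fst

@[simp] theorem branches_node (F : Forest) : branches (node F) = F := by
  rw [branches, recurse_node]
  simp

/-- The number `|τ|` of nodes. -/
def size : RTree → ℕ := recurse fun B => 1 + (B.map Prod.snd).sum

theorem size_node (F : Forest) : size (node F) = 1 + (F.map size).sum := by
  simp [size, recurse_node]

theorem size_pos (τ : RTree) : 0 < size τ := by
  obtain ⟨F, rfl⟩ := exists_eq_node τ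
  rw [size_node]
  omega

theorem size_lt_of_mem {F : Forest} {τ : RTree} (h : τ ∈ F) : size τ < size (node F) := by
  rw [size_node]
  have := Multiset.single_le_sum (s := F.map size) (fun _ _ => Nat.zero_le _) _
    (Multiset.mem_map_of_mem size h)
  omega

/-- Structural induction on rooted trees. -/
theorem induction {p : RTree → Prop} (h : ∀ F : Forest, (∀ τ ∈ F, p τ) → p (node F))
    (τ : RTree) : p τ := by
  induction hn : size τ using Nat.strong_induction_on generalizing τ with
  | _ n ih =>
    obtain ⟨F, rfl⟩ := exists_eq_node τ
    exact h F fun σ hσ => ih _ (hn ▸ size_lt_of_mem hσ) σ rfl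

/-- The tree factorial: `[τ₁, …, τₖ]! = |[τ₁, …, τₖ]| · τ₁! ⋯ τₖ!`. -/
def factorial : RTree → ℕ :=
  recurse fun B => (1 + (B.map fun q => size q.1).sum) * (B.map Prod.snd).prod

/-- The cuts of `τ` (subsets `c` of its edges), each recorded as `(|c|, P_c, R_c)`: the number of edges
in the cut, the forest of the components without the root, and the component of the root.
For each branch `σ` of the root one decides whether its edge to the root belongs to the cut, and chooses
a cut of `σ`; then the root component of `σ` is either split off or remains a branch of the root. -/
noncomputable def cuts : RTree → Multiset (ℕ × Forest × RTree) :=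
  recurse fun B =>
    (B.map fun q : RTree × Multiset (ℕ × Forest × RTree) =>
      (q.2.map fun c => ((c.1 + 1, c.2.1 + {c.2.2}, 0) : ℕ × Forest × Forest)) +
      (q.2.map fun c => ((c.1, c.2.1, {c.2.2}) : ℕ × Forest × Forest))).Sections.map
    fun s => (s.sum.1, s.sum.2.1, node s.sum.2.2)

/-- The admissible cuts of `τ` other than the total cut, each recorded as `(P_c, R_c)`; a path from the
root meets at most one edge of the cut. For each branch `σ` of the root, either its edge to the root is
cut, and then no edge of `σ` is, or it is not, and an admissible cut of `σ` is chosen. The empty cut is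
recorded as `(0, τ)`. -/
noncomputable def admissibleCuts : RTree → Multiset (Forest × RTree) :=
  recurse fun B =>
    (B.map fun q : RTree × Multiset (Forest × RTree) =>
      (({q.1}, 0) : Forest × Forest) ::ₘ
        q.2.map fun c => ((c.1, {c.2}) : Forest × Forest)).Sections.map
    fun s => (s.sum.1, node s.sum.2)

open scoped Classical in
/-- `Adm(τ)`: the admissible cuts that are neither total nor empty. -/
noncomputable def properCuts (τ : RTree) : Multiset (Forest × RTree) :=
  (admissibleCuts τ).filter fun c => c.1 ≠ 0

theorem cuts_node (F : Forest) : cuts (node F) =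
    (F.map fun σ =>
      ((cuts σ).map fun c => ((c.1 + 1, c.2.1 + {c.2.2}, 0) : ℕ × Forest × Forest)) +
      ((cuts σ).map fun c => ((c.1, c.2.1, {c.2.2}) : ℕ × Forest × Forest))).Sections.map
    fun s => (s.sum.1, s.sum.2.1, node s.sum.2.2) := by
  rw [cuts, recurse_node, Multiset.map_map]
  rfl

theorem admissibleCuts_node (F : Forest) : admissibleCuts (node F) =
    (F.map fun σ => (({σ}, 0) : Forest × Forest) ::ₘ
        (admissibleCuts σ).map fun c => ((c.1, {c.2}) : Forest × Forest)).Sections.map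
    fun s => (s.sum.1, node s.sum.2) := by
  rw [admissibleCuts, recurse_node, Multiset.map_map]
  rfl

theorem sections_size {f : RTree → Multiset (Forest × Forest)} (F : Forest)
    (hf : ∀ σ ∈ F, ∀ a ∈ f σ, (a.1.map size).sum + (a.2.map size).sum = size σ) :
    ∀ s ∈ (F.map f).Sections,
      (s.sum.1.map size).sum + (s.sum.2.map size).sum = (F.map size).sum := by
  induction F using Multiset.induction with
  | empty => simp
  | cons σ F ih =>
    intro s hs
    rw [Multiset.map_cons, Multiset.sections_cons, Multiset.mem_bind] at hs
    obtain ⟨a, ha, hs⟩ := hs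
    obtain ⟨u, hu, rfl⟩ := Multiset.mem_map.1 hs
    have h1 : (Multiset.map size a.1).sum + (Multiset.map size a.2).sum = size σ :=
      hf σ (Multiset.mem_cons_self _ _) a ha
    have h2 : (Multiset.map size u.sum.1).sum + (Multiset.map size u.sum.2).sum =
        (Multiset.map size F).sum := ih (fun σ' h' => hf σ' (Multiset.mem_cons_of_mem h')) u hu
    rw [Multiset.sum_cons, Prod.fst_add, Prod.snd_add, Multiset.map_add, Multiset.map_add,
      Multiset.sum_add, Multiset.sum_add, Multiset.map_cons, Multiset.sum_cons]
    omega

/-- A cut distributes the nodes of the tree over `P_c` and `R_c`. -/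
theorem size_of_mem_admissibleCuts (τ : RTree) :
    ∀ c ∈ admissibleCuts τ, (c.1.map size).sum + size c.2 = size τ := by
  induction τ using RTree.induction with
  | h F ih =>
    intro c hc
    rw [admissibleCuts_node] at hc
    obtain ⟨s, hs, rfl⟩ := Multiset.mem_map.1 hc
    have h := sections_size F (fun σ hσ a ha => by
      rcases Multiset.mem_cons.1 ha with rfl | ha
      · simp
      · obtain ⟨c, hc, rfl⟩ := Multiset.mem_map.1 ha
        simpa using ih σ hσ c hc) s hs
    simp only [size_node]
    omega

theorem size_lt_of_mem_properCuts {τ : RTree} {c : Forest × RTree} (hc : c ∈ properCuts τ) :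
    (∀ σ ∈ c.1, size σ < size τ) ∧ size c.2 < size τ := by
  classical
  unfold properCuts at hc
  obtain ⟨hc, h0⟩ := Multiset.mem_filter.1 hc
  have h := size_of_mem_admissibleCuts τ c hc
  have h2 := size_pos c.2
  have h3 : ∀ σ ∈ c.1, size σ ≤ (c.1.map size).sum := fun σ hσ =>
    Multiset.single_le_sum (fun _ _ => Nat.zero_le _) _ (Multiset.mem_map_of_mem size hσ)
  obtain ⟨σ, hσ⟩ := Multiset.exists_mem_of_ne_zero h0
  have h4 := h3 σ hσ
  have h5 := size_pos σ
  exact ⟨fun ρ hρ => by have := h3 ρ hρ; omega, by omega⟩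

open scoped Classical in
theorem sections_filter {f : RTree → Multiset (Forest × Forest)} (F : Forest)
    (hf : ∀ σ ∈ F, (f σ).filter (fun a => a.1 = 0) = {(0, {σ})}) :
    ((F.map f).Sections.map Multiset.sum).filter (fun a => a.1 = 0) = {(0, F)} := by
  induction F using Multiset.induction with
  | empty => simp [Multiset.filter_singleton, Prod.ext_iff]
  | cons σ F ih =>
    have h1 := hf σ (Multiset.mem_cons_self _ _)
    have h2 := ih fun σ' h' => hf σ' (Multiset.mem_cons_of_mem h')
    have key : ∀ (U V : Multiset (Forest × Forest)),
        (U.bind fun a => V.map fun v => a + v).filter (fun a => a.1 = 0) =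
          (U.filter fun a => a.1 = 0).bind fun a =>
            (V.filter fun a => a.1 = 0).map fun v => a + v := by
      intro U V
      induction U using Multiset.induction with
      | empty => simp
      | cons a U ihU =>
        rw [Multiset.cons_bind, Multiset.filter_add, ihU, Multiset.filter_map]
        by_cases ha : a.1 = 0
        · rw [Multiset.filter_cons_of_pos (p := fun a : Forest × Forest => a.1 = 0) _ ha, Multiset.cons_bind]
          congr 2
          refine Multiset.filter_congr fun v _ => ?_
          simp [ha]
        · rw [Multiset.filter_cons_of_neg (p := fun a : Forest × Forest => a.1 = 0) _ ha]
          have : V.filter ((fun a => a.1 = 0) ∘ fun v => a + v) = 0 := by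
            rw [Multiset.filter_eq_nil]
            intro v _
            simp [ha]
          rw [this]
          simp
    have h3 : ((σ ::ₘ F).map f).Sections.map Multiset.sum =
        (f σ).bind fun a => ((F.map f).Sections.map Multiset.sum).map fun v => a + v := by
      rw [Multiset.map_cons, Multiset.sections_cons, Multiset.map_bind]
      simp [Multiset.map_map]
    rw [h3, key, h1, h2]
    simp

open scoped Classical in
/-- The empty cut occurs exactly once among the admissible cuts. -/
theorem admissibleCuts_filter (τ : RTree) :
    (admissibleCuts τ).filter (fun c => c.1 = 0) = {(0, τ)} := by
  induction τ using RTree.induction with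
  | h F ih =>
    have h := sections_filter (f := fun σ => (({σ}, 0) : Forest × Forest) ::ₘ
        (admissibleCuts σ).map fun c => ((c.1, {c.2}) : Forest × Forest)) F (fun σ hσ => by
      rw [Multiset.filter_cons_of_neg _ (by simp), Multiset.filter_map]
      have := ih σ hσ
      simp only [Function.comp_def]
      rw [this]
      simp)
    have h' := congrArg (Multiset.map fun a : Forest × Forest => (a.1, node a.2)) h
    rw [Multiset.map_singleton] at h'
    rw [← h', admissibleCuts_node, Multiset.filter_map, Multiset.filter_map, Multiset.map_map]
    rfl

theorem admissibleCuts_eq (τ : RTree) : admissibleCuts τ = (0, τ) ::ₘ properCuts τ := by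
  classical
  have h := Multiset.filter_add_not (fun c : Forest × RTree => c.1 = 0) (admissibleCuts τ)
  rw [admissibleCuts_filter] at h
  rw [← h, Multiset.singleton_add]
  congr 1

end RTree

/-! ## The Butcher–Connes–Kreimer Hopf algebra -/

/-- The free commutative `ℝ`-algebra on the non-empty trees; the empty forest is the unit `1`. -/
abbrev BCK : Type := MvPolynomial RTree ℝ

namespace BCK

/-- A tree as an element of the algebra. -/
noncomputable def tree (τ : RTree) : BCK := MvPolynomial.X τ

/-- A forest as an element of the algebra: the product of its trees. -/
noncomputable def forest (F : Forest) : BCK := (F.map tree).prod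

/-- The reduced coproduct `δ(τ) = ∑_{c ∈ Adm(τ)} P_c(τ) ⊗ R_c(τ)` of a tree. -/
noncomputable def reducedCoproduct (τ : RTree) : BCK ⊗[ℝ] BCK :=
  (τ.properCuts.map fun c => forest c.1 ⊗ₜ[ℝ] tree c.2).sum

/-- The coproduct, `Δ(τ) = τ ⊗ ∅ + ∅ ⊗ τ + δ(τ)` on trees. -/
noncomputable def coproduct : BCK →ₐ[ℝ] BCK ⊗[ℝ] BCK :=
  MvPolynomial.aeval fun τ => tree τ ⊗ₜ[ℝ] 1 + 1 ⊗ₜ[ℝ] tree τ + reducedCoproduct τ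

/-- The convolution product `f g = μ ∘ (f ⊗ g) ∘ Δ` of algebra maps. -/
noncomputable def conv {A : Type} [CommRing A] [Algebra ℝ A] (f g : BCK →ₐ[ℝ] A) : BCK →ₐ[ℝ] A :=
  (Algebra.TensorProduct.lmul' ℝ).comp ((Algebra.TensorProduct.map f g).comp coproduct)

/-- The antipode, `S(τ) = ∑_c (-1)^{|c|+1} τ^c` on trees, the sum being over all cuts `c` of `τ`, where
`τ^c` is the forest that remains when the edges in `c` are removed. -/
noncomputable def antipode : BCK →ₐ[ℝ] BCK :=
  MvPolynomial.aeval fun τ =>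
    (τ.cuts.map fun c => (-1 : BCK) ^ (c.1 + 1) * (forest c.2.1 * tree c.2.2)).sum

/-- The canonical involution `τ ↦ (-1)^{|τ|} τ`. -/
noncomputable def involution : BCK →ₐ[ℝ] BCK :=
  MvPolynomial.aeval fun τ => (-1 : BCK) ^ τ.size * tree τ

/-- `S̄(τ) = (-1)^{|τ|} S(τ)`. -/
noncomputable def antipodeBar : BCK →ₐ[ℝ] BCK := antipode.comp involution

/-- Iterates of the recursion `φ(τ) = ½ (τ - μ ∘ (φ ⊗ φ) ∘ δ(τ))`. -/
noncomputable def sqrtIdAux : ℕ → (BCK →ₐ[ℝ] BCK)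
  | 0 => AlgHom.id ℝ BCK
  | n + 1 => MvPolynomial.aeval fun τ => (1 / 2 : ℝ) • (tree τ -
      Algebra.TensorProduct.lmul' ℝ
        (Algebra.TensorProduct.map (sqrtIdAux n) (sqrtIdAux n) (reducedCoproduct τ)))

/-- The square root `Id^{1/2}` of the identity for the convolution product: the multiplicative map with
`Id^{1/2}(τ) = ½ (τ - μ ∘ (Id^{1/2} ⊗ Id^{1/2}) ∘ δ(τ))` on trees. See `sqrtId_tree` and
`conv_sqrtId_sqrtId`. -/
noncomputable def sqrtId : BCK →ₐ[ℝ] BCK :=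
  MvPolynomial.aeval fun τ => sqrtIdAux τ.size (tree τ)

theorem coproduct_tree (τ : RTree) :
    coproduct (tree τ) = tree τ ⊗ₜ[ℝ] 1 + 1 ⊗ₜ[ℝ] tree τ + reducedCoproduct τ := by
  simp [coproduct, tree]

/-- The coproduct is the sum over the total cut and all other admissible cuts. -/
theorem coproduct_tree_eq_sum (τ : RTree) : coproduct (tree τ) =
    tree τ ⊗ₜ[ℝ] 1 + (τ.admissibleCuts.map fun c => forest c.1 ⊗ₜ[ℝ] tree c.2).sum := by
  rw [coproduct_tree, RTree.admissibleCuts_eq, Multiset.map_cons, Multiset.sum_cons, add_assoc]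
  simp [reducedCoproduct, forest]

theorem sqrtIdAux_stable (n : ℕ) : ∀ (m : ℕ) (τ : RTree), τ.size ≤ n → τ.size ≤ m →
    sqrtIdAux n (tree τ) = sqrtIdAux m (tree τ) := by
  induction n with
  | zero =>
    intro m τ h
    have := τ.size_pos
    omega
  | succ n ih =>
    intro m τ hn hm
    cases m with
    | zero =>
      have := τ.size_pos
      omega
    | succ m =>
      simp only [sqrtIdAux, tree, MvPolynomial.aeval_X]
      congr 3
      simp only [reducedCoproduct, map_multiset_sum, Multiset.map_map]
      congr 1
      refine Multiset.map_congr rfl fun c hc => ?_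
      obtain ⟨h1, h2⟩ := RTree.size_lt_of_mem_properCuts hc
      have hR : sqrtIdAux n (tree c.2) = sqrtIdAux m (tree c.2) := ih m _ (by omega) (by omega)
      have hP : sqrtIdAux n (forest c.1) = sqrtIdAux m (forest c.1) := by
        simp only [forest, map_multiset_prod, Multiset.map_map]
        congr 1
        refine Multiset.map_congr rfl fun σ hσ => ?_
        have := h1 σ hσ
        exact ih m σ (by omega) (by omega)
      simp [hR, hP]

/-- The recursion that characterises `Id^{1/2}`. -/
theorem sqrtId_tree (τ : RTree) : sqrtId (tree τ) = (1 / 2 : ℝ) • (tree τ -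
    Algebra.TensorProduct.lmul' ℝ
      (Algebra.TensorProduct.map sqrtId sqrtId (reducedCoproduct τ))) := by
  obtain ⟨n, hn⟩ : ∃ n, τ.size = n + 1 := ⟨τ.size - 1, by have := τ.size_pos; omega⟩
  have h0 : ∀ σ : RTree, σ.size ≤ n → sqrtIdAux n (tree σ) = sqrtId (tree σ) := by
    intro σ hσ
    have : sqrtId (tree σ) = sqrtIdAux σ.size (tree σ) := by
      simp [sqrtId, tree]
    rw [this]
    exact sqrtIdAux_stable _ _ _ hσ le_rfl
  have h1 : sqrtId (tree τ) = sqrtIdAux (n + 1) (tree τ) := by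
    rw [← hn]
    simp [sqrtId, tree]
  rw [h1]
  simp only [sqrtIdAux]
  rw [tree, MvPolynomial.aeval_X]
  congr 3
  simp only [reducedCoproduct, map_multiset_sum, Multiset.map_map]
  congr 1
  refine Multiset.map_congr rfl fun c hc => ?_
  obtain ⟨h1, h2⟩ := RTree.size_lt_of_mem_properCuts hc
  have hR : sqrtIdAux n (tree c.2) = sqrtId (tree c.2) := h0 _ (by omega)
  have hP : sqrtIdAux n (forest c.1) = sqrtId (forest c.1) := by
    simp only [forest, map_multiset_prod, Multiset.map_map]
    congr 1
    refine Multiset.map_congr rfl fun σ hσ => ?_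
    have := h1 σ hσ
    exact h0 σ (by omega)
  simp [hR, hP]

/-- `Id^{1/2}` is a square root of `Id` for the convolution product. -/
theorem conv_sqrtId_sqrtId : conv sqrtId sqrtId = AlgHom.id ℝ BCK := by
  refine MvPolynomial.algHom_ext fun τ => ?_
  change Algebra.TensorProduct.lmul' ℝ
    (Algebra.TensorProduct.map sqrtId sqrtId (coproduct (tree τ))) = tree τ
  have h := sqrtId_tree τ
  rw [coproduct_tree]
  simp only [map_add, Algebra.TensorProduct.map_tmul, map_one,
    Algebra.TensorProduct.lmul'_apply_tmul, mul_one, one_mul]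
  rw [h, ← two_smul ℝ (_ • (_ - _) : BCK)] 
  simp [smul_smul]

/-- `τ⁻ = μ ∘ (S̄ ⊗ Id) ∘ Δ ∘ Id^{1/2}(τ)`. -/
noncomputable def minus : BCK →ₐ[ℝ] BCK := (conv antipodeBar (AlgHom.id ℝ BCK)).comp sqrtId

/-- `τ⁺ = μ ∘ (Id ⊗ (·)⁻ ∘ S) ∘ Δ(τ)`. -/
noncomputable def plus : BCK →ₐ[ℝ] BCK := conv (AlgHom.id ℝ BCK) (minus.comp antipode)

end BCK

/-- A character of the Hopf algebra. -/
abbrev Character : Type := BCK →ₐ[ℝ] ℝ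

namespace Character

/-- `ord(ψ) = sup {n : ψ(τ) = 1/τ! for all |τ| ≤ n}`. -/
noncomputable def ord (ψ : Character) : ℕ∞ :=
  ⨆ (n : ℕ) (_ : ∀ τ : RTree, τ.size ≤ n → ψ (BCK.tree τ) = 1 / (τ.factorial : ℝ)), (n : ℕ∞)

/-- The antisymmetric order `ord⁺(ψ) = sup {n : ψ(τ⁺) = 0 for all |τ| ≤ n}`, over non-empty `τ`. -/
noncomputable def antisymOrd (ψ : Character) : ℕ∞ :=
  ⨆ (n : ℕ) (_ : ∀ τ : RTree, τ.size ≤ n → ψ (BCK.plus (BCK.tree τ)) = 0), (n : ℕ∞)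

end Character

/-! ## Runge–Kutta schemes -/

/-- An `s`-stage Runge–Kutta scheme, given by its Butcher tableau. -/
@[ext] structure RKScheme (s : ℕ) where
  /-- The Runge–Kutta matrix. -/
  A : Matrix (Fin s) (Fin s) ℝ
  /-- The weights. -/
  b : Fin s → ℝ

namespace RKScheme

variable {s : ℕ}

/-- The scheme is explicit: `A` is strictly lower triangular. -/
def IsExplicit (Ψ : RKScheme s) : Prop := ∀ i j : Fin s, i ≤ j → Ψ.A i j = 0

/-- The derivative weights:
`(ψᵢD)([τ₁, …, τₖ]) = ∏ₗ ψᵢ(τₗ)` with the internal weights `ψᵢ(τ) = ∑ⱼ aᵢⱼ (ψⱼD)(τ)`. -/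
noncomputable def derivativeWeight (Ψ : RKScheme s) : RTree → Fin s → ℝ :=
  RTree.recurse fun B i =>
    (B.map fun q : RTree × (Fin s → ℝ) => ∑ j, Ψ.A i j * q.2 j).prod

/-- The elementary weights `ψ(τ) = ∑ᵢ bᵢ (ψᵢD)(τ)`, as a character. -/
noncomputable def character (Ψ : RKScheme s) : Character :=
  MvPolynomial.aeval fun τ => ∑ i, Ψ.b i * Ψ.derivativeWeight τ i

/-- `Ψ ∈ EES(n, m)`: the scheme is explicit, of order exactly `n` and of antisymmetric order
exactly `m`. -/
def IsEES (Ψ : RKScheme s) (n m : ℕ) : Prop :=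
  Ψ.IsExplicit ∧ Ψ.character.ord = n ∧ Ψ.character.antisymOrd = m

end RKScheme

/-!
The antisymmetric order measures how far the character `ψ` agrees with `ψ ∘ S̄`: writing `τ⁺`
through convolution inverses and using the uniqueness of square roots, `ψ(τ⁺) = 0` for `|τ| ≤ n` if
and only if `ψ` and `ψ ∘ S̄` agree on the trees with at most `n` nodes. For a Runge–Kutta scheme
`ψ ∘ S̄` is the character of the adjoint scheme, whose matrix is `(bⱼ - aᵢⱼ)`. The first order at
which `ψ` and `ψ ∘ S̄` disagree is even, so antisymmetric order `7` means agreement on the trees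
with at most six nodes and disagreement on some tree with eight.

For an explicit four-stage scheme put `c = A 1`, `d = A c` and `g = A d`; then `A g = 0` and
`c g` is a multiple of `g`. Comparing the two characters on a few trees determines the moments of
`c`, `d` and `g` and expresses `c c` and `c d` through `c`, `d` and `g`. Conversely, these
relations reduce the internal weights of all forests with at most five nodes, for the scheme and
its adjoint simultaneously, to nine elements on which the comparison is a finite computation,
while the tall tree with eight nodes always tells the two characters apart. Since `1`, `c`, `d`,
`g` turn out to form a basis, the relations and the second abscissa `k` determine the scheme,
and `k = s (1 - s - 2 x) / (4 (x - 1))` is solved by the parameter `x` of the family.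
-/

/-! ### The Connes–Kreimer bialgebra -/

theorem prod_map_sum_map_eq_sum_sections {α R : Type*} [AddCommMonoid α] [CommSemiring R]
    {T : α → R} (h_zero : T 0 = 1) (h_add : ∀ a b, T (a + b) = T a * T b)
    (G : Multiset (Multiset α)) :
    (G.map fun m => (m.map T).sum).prod = (G.Sections.map fun s => T s.sum).sum := by
  induction G using Multiset.induction with
  | empty => simp [h_zero]
  | cons m G ih =>
    simp [ih, h_add, Multiset.map_bind, Multiset.sum_map_mul_left, Multiset.sum_map_mul_right]

namespace BCK

theorem forest_zero : forest 0 = 1 := by simp [forest]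

theorem forest_singleton (τ : RTree) : forest {τ} = tree τ := by simp [forest]

theorem forest_add (F G : Forest) : forest (F + G) = forest F * forest G := by
  simp [forest]

theorem map_forest {A : Type*} [CommSemiring A] [Algebra ℝ A] (f : BCK →ₐ[ℝ] A) (F : Forest) :
    f (forest F) = (F.map fun τ => f (tree τ)).prod := by
  rw [forest, map_multiset_prod, Multiset.map_map]
  rfl

theorem map_forest_congr {A : Type*} [CommSemiring A] [Algebra ℝ A] {f g : BCK →ₐ[ℝ] A}
    {F : Forest} (h : ∀ τ ∈ F, f (tree τ) = g (tree τ)) : f (forest F) = g (forest F) := by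
  rw [map_forest, map_forest, Multiset.map_congr rfl h]

theorem algHom_ext_tree {A : Type*} [CommSemiring A] [Algebra ℝ A] {f g : BCK →ₐ[ℝ] A}
    (h : ∀ τ, f (tree τ) = g (tree τ)) : f = g :=
  MvPolynomial.algHom_ext h

open scoped Classical in
theorem forest_eq_monomial (F : Forest) :
    forest F = MvPolynomial.monomial (Multiset.toFinsupp F) (1 : ℝ) := by
  induction F using Multiset.induction with
  | empty => simp [forest]
  | cons τ F ih =>
    rw [← Multiset.singleton_add, forest_add, ih, forest_singleton, tree, MvPolynomial.X,
      MvPolynomial.monomial_mul, map_add, Multiset.toFinsupp_singleton, one_mul]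

theorem linearMap_ext_forest {M : Type*} [AddCommMonoid M] [Module ℝ M] {f g : BCK →ₗ[ℝ] M}
    (h : ∀ F, f (forest F) = g (forest F)) : f = g := by
  classical
  refine (MvPolynomial.basisMonomials RTree ℝ).ext fun m => ?_
  simpa [forest_eq_monomial] using h (Finsupp.toMultiset m)

/-- The grafting operator `B₊`, joining the trees of a forest to a new root. -/
noncomputable def graft : BCK →ₗ[ℝ] BCK :=
  (MvPolynomial.basisMonomials RTree ℝ).constr ℝ fun m => tree (RTree.node (Finsupp.toMultiset m))

theorem graft_forest (F : Forest) : graft (forest F) = tree (RTree.node F) := by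
  classical
  have h := (MvPolynomial.basisMonomials RTree ℝ).constr_basis ℝ
    (fun m => tree (RTree.node (Finsupp.toMultiset m))) (Multiset.toFinsupp F)
  rw [MvPolynomial.coe_basisMonomials, Multiset.toFinsupp_toMultiset] at h
  rw [forest_eq_monomial]
  exact h

theorem algHom_ext_graft {A : Type*} [CommSemiring A] [Algebra ℝ A] {f g : BCK →ₐ[ℝ] A}
    (h : ∀ F, f (forest F) = g (forest F) → f (graft (forest F)) = g (graft (forest F))) :
    f = g := by
  refine algHom_ext_tree fun τ => ?_
  induction τ using RTree.induction with
  | h F ih =>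
    rw [← graft_forest]
    exact h F (map_forest_congr ih)

theorem coproduct_forest (F : Forest) : coproduct (forest F) =
    ((F.map fun σ => (({σ}, 0) : Forest × Forest) ::ₘ
        σ.admissibleCuts.map fun c => ((c.1, {c.2}) : Forest × Forest)).Sections.map
      fun s => forest s.sum.1 ⊗ₜ[ℝ] forest s.sum.2).sum := by
  rw [← prod_map_sum_map_eq_sum_sections
      (T := fun a : Forest × Forest => forest a.1 ⊗ₜ[ℝ] forest a.2)
    (by simp [forest_zero, Algebra.TensorProduct.one_def])
    fun a b => by simp [forest_add, Algebra.TensorProduct.tmul_mul_tmul],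
    map_forest, Multiset.map_map]
  congr 1
  refine Multiset.map_congr rfl fun σ _ => ?_
  simp [coproduct_tree_eq_sum, forest_singleton, forest_zero]

theorem coproduct_graft (x : BCK) :
    coproduct (graft x) = graft x ⊗ₜ[ℝ] 1 + graft.lTensor BCK (coproduct x) := by
  have h : coproduct.toLinearMap ∘ₗ graft = (TensorProduct.mk ℝ BCK BCK).flip 1 ∘ₗ graft +
      graft.lTensor BCK ∘ₗ coproduct.toLinearMap := by
    refine linearMap_ext_forest fun F => ?_
    simp [graft_forest, coproduct_tree_eq_sum, coproduct_forest, RTree.admissibleCuts_node,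
      map_multiset_sum, Function.comp_def]
  exact LinearMap.congr_fun h x

theorem assoc_map_coproduct_lTensor_graft (y : BCK ⊗[ℝ] BCK) :
    Algebra.TensorProduct.assoc ℝ ℝ ℝ BCK BCK BCK
        (Algebra.TensorProduct.map coproduct (.id ℝ BCK) (graft.lTensor BCK y)) =
      (graft.lTensor BCK).lTensor BCK (Algebra.TensorProduct.assoc ℝ ℝ ℝ BCK BCK BCK
        (Algebra.TensorProduct.map coproduct (.id ℝ BCK) y)) := by
  induction y using TensorProduct.induction_on with
  | zero => simp
  | add a b ha hb => simp only [map_add, ha, hb]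
  | tmul a b =>
    simp only [LinearMap.lTensor_tmul, Algebra.TensorProduct.map_tmul, AlgHom.id_apply]
    induction coproduct a using TensorProduct.induction_on with
    | zero => simp
    | add a b ha hb => simp only [map_add, TensorProduct.add_tmul, ha, hb]
    | tmul a c => simp

theorem map_id_coproduct_lTensor_graft (y : BCK ⊗[ℝ] BCK) :
    Algebra.TensorProduct.map (.id ℝ BCK) coproduct (graft.lTensor BCK y) =
      Algebra.TensorProduct.assoc ℝ ℝ ℝ BCK BCK BCK (graft.lTensor BCK y ⊗ₜ[ℝ] 1) +
      (graft.lTensor BCK).lTensor BCK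
        (Algebra.TensorProduct.map (.id ℝ BCK) coproduct y) := by
  induction y using TensorProduct.induction_on with
  | zero => simp
  | add a b ha hb =>
    simp only [map_add, TensorProduct.add_tmul, ha, hb]
    abel
  | tmul a b => simp [coproduct_graft, TensorProduct.tmul_add]

theorem coproduct_coassoc : (Algebra.TensorProduct.assoc ℝ ℝ ℝ BCK BCK BCK).toAlgHom.comp
      ((Algebra.TensorProduct.map coproduct (.id ℝ BCK)).comp coproduct) =
    (Algebra.TensorProduct.map (.id ℝ BCK) coproduct).comp coproduct := by
  refine algHom_ext_graft (A := BCK ⊗[ℝ] (BCK ⊗[ℝ] BCK)) fun F ih => ?_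
  simp only [AlgHom.comp_apply, AlgEquiv.toAlgHom_apply] at ih ⊢
  rw [coproduct_graft, map_add, map_add, assoc_map_coproduct_lTensor_graft, ih, map_add,
    map_id_coproduct_lTensor_graft]
  simp [coproduct_graft, TensorProduct.add_tmul, add_assoc, Algebra.TensorProduct.one_def]

/-- The counit, vanishing on non-empty trees. -/
noncomputable def counit : Character := MvPolynomial.aeval fun _ => 0

theorem counit_tree (τ : RTree) : counit (tree τ) = 0 := by simp [counit, tree]

theorem counit_forest {F : Forest} (h : F ≠ 0) : counit (forest F) = 0 := by
  obtain ⟨τ, hτ⟩ := Multiset.exists_mem_of_ne_zero h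
  rw [map_forest]
  exact Multiset.prod_eq_zero (Multiset.mem_map.2 ⟨τ, hτ, counit_tree τ⟩)

theorem map_counit_id_reducedCoproduct (τ : RTree) :
    Algebra.TensorProduct.map counit (.id ℝ BCK) (reducedCoproduct τ) = 0 := by
  classical
  rw [reducedCoproduct, map_multiset_sum, Multiset.map_map]
  refine Multiset.sum_eq_zero fun y hy => ?_
  obtain ⟨c, hc, rfl⟩ := Multiset.mem_map.1 hy
  rw [Function.comp_apply, Algebra.TensorProduct.map_tmul,
    counit_forest (Multiset.mem_filter.1 hc).2, TensorProduct.zero_tmul]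

theorem map_id_counit_reducedCoproduct (τ : RTree) :
    Algebra.TensorProduct.map (.id ℝ BCK) counit (reducedCoproduct τ) = 0 := by
  rw [reducedCoproduct, map_multiset_sum, Multiset.map_map]
  refine Multiset.sum_eq_zero fun y hy => ?_
  obtain ⟨c, -, rfl⟩ := Multiset.mem_map.1 hy
  rw [Function.comp_apply, Algebra.TensorProduct.map_tmul, counit_tree, TensorProduct.tmul_zero]

noncomputable instance : Bialgebra ℝ BCK :=
  .ofAlgHom coproduct counit coproduct_coassoc
    (algHom_ext_tree fun τ => by
      simp [coproduct_tree, map_counit_id_reducedCoproduct, counit_tree])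
    (algHom_ext_tree fun τ => by
      simp [coproduct_tree, map_id_counit_reducedCoproduct, counit_tree])

section Convolution

variable {A : Type} [CommRing A] [Algebra ℝ A]

theorem conv_assoc (f g h : BCK →ₐ[ℝ] A) : conv (conv f g) h = conv f (conv g h) :=
  congrArg WithConv.ofConv (mul_assoc (WithConv.toConv f) (WithConv.toConv g) (WithConv.toConv h))

theorem comp_conv {B : Type} [CommRing B] [Algebra ℝ B] (h : A →ₐ[ℝ] B) (f g : BCK →ₐ[ℝ] A) :
    h.comp (conv f g) = conv (h.comp f) (h.comp g) :=
  AlgHom.comp_convMul_distrib h (.toConv f) (.toConv g)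

theorem counit_conv (f : Character) : conv counit f = f :=
  congrArg WithConv.ofConv (one_mul (WithConv.toConv f))

theorem conv_counit (f : Character) : conv f counit = f :=
  congrArg WithConv.ofConv (mul_one (WithConv.toConv f))

end Convolution

/-- The signed sum `∑_c (-1)^{|c|} P_c ⊗ R_c` over all cuts of a tree, which records the component
of the root apart from the other components. -/
noncomputable def cutSum (τ : RTree) : BCK ⊗[ℝ] BCK :=
  (τ.cuts.map fun c => (-1 : ℝ) ^ c.1 • forest c.2.1 ⊗ₜ[ℝ] tree c.2.2).sum

theorem antipode_tree (τ : RTree) :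
    antipode (tree τ) = -(τ.cuts.map fun c => (-1 : ℝ) ^ c.1 • forest (c.2.1 + {c.2.2})).sum := by
  rw [antipode, tree, MvPolynomial.aeval_X, ← Multiset.sum_map_neg', Multiset.map_map]
  congr 1
  refine Multiset.map_congr rfl fun c _ => ?_
  simp [pow_succ, Algebra.smul_def, forest_add, forest_singleton]

theorem antipode_tree_eq_neg_lmul_cutSum (τ : RTree) :
    antipode (tree τ) = -Algebra.TensorProduct.lmul' ℝ (cutSum τ) := by
  simp [antipode_tree, cutSum, map_multiset_sum, forest_add, forest_singleton, Function.comp_def]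

theorem antipode_tree_tmul_one (τ : RTree) : antipode (tree τ) ⊗ₜ[ℝ] (1 : BCK) =
    (τ.cuts.map fun c => (-1 : ℝ) ^ (c.1 + 1) • forest (c.2.1 + {c.2.2}) ⊗ₜ[ℝ] forest 0).sum := by
  change (TensorProduct.mk ℝ BCK BCK).flip 1 (antipode (tree τ)) = _
  rw [antipode_tree, map_neg, map_multiset_sum, ← Multiset.sum_map_neg', Multiset.map_map,
    Multiset.map_map]
  simp [forest_zero, pow_succ, TensorProduct.smul_tmul', TensorProduct.neg_tmul,
    Function.comp_def]

theorem cutSum_node (F : Forest) : cutSum (RTree.node F) =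
    graft.lTensor BCK (F.map fun σ => antipode (tree σ) ⊗ₜ[ℝ] 1 + cutSum σ).prod := by
  let T : ℕ × Forest × Forest → BCK ⊗[ℝ] BCK := fun a =>
    (-1 : ℝ) ^ a.1 • forest a.2.1 ⊗ₜ[ℝ] forest a.2.2
  have T_zero : T 0 = 1 := by simp [T, forest_zero, Algebra.TensorProduct.one_def]
  have T_add (a b) : T (a + b) = T a * T b := by
    simp only [T, Prod.fst_add, Prod.snd_add, forest_add, pow_add, smul_mul_smul_comm,
      Algebra.TensorProduct.tmul_mul_tmul]
  have h := prod_map_sum_map_eq_sum_sections T_zero T_add (F.map fun σ =>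
    (σ.cuts.map fun c => ((c.1 + 1, c.2.1 + {c.2.2}, 0) : ℕ × Forest × Forest)) +
      (σ.cuts.map fun c => ((c.1, c.2.1, {c.2.2}) : ℕ × Forest × Forest)))
  simp only [T, Multiset.map_map, Function.comp_def, Multiset.map_add, Multiset.sum_add,
    forest_singleton, ← antipode_tree_tmul_one] at h
  simp only [cutSum, h, RTree.cuts_node, map_multiset_sum, Multiset.map_map, Function.comp_def,
    map_smul, LinearMap.lTensor_tmul, graft_forest]

theorem map_antipode_id_lTensor_graft (y : BCK ⊗[ℝ] BCK) :
    Algebra.TensorProduct.map antipode (.id ℝ BCK) (graft.lTensor BCK y) =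
      graft.lTensor BCK (Algebra.TensorProduct.map antipode (.id ℝ BCK) y) := by
  induction y using TensorProduct.induction_on with
  | zero => simp
  | add a b ha hb => simp only [map_add, ha, hb]
  | tmul a b => simp

theorem map_antipode_id_coproduct_tree (τ : RTree) :
    Algebra.TensorProduct.map antipode (.id ℝ BCK) (coproduct (tree τ)) =
      antipode (tree τ) ⊗ₜ[ℝ] 1 + cutSum τ := by
  induction τ using RTree.induction with
  | h F ih =>
    have h : Algebra.TensorProduct.map antipode (.id ℝ BCK) (coproduct (forest F)) =
        (F.map fun σ => antipode (tree σ) ⊗ₜ[ℝ] 1 + cutSum σ).prod := by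
      rw [← AlgHom.comp_apply, map_forest]
      exact congrArg _ (Multiset.map_congr rfl ih)
    rw [cutSum_node, ← h, ← graft_forest, coproduct_graft, map_add, map_antipode_id_lTensor_graft,
      Algebra.TensorProduct.map_tmul, map_one]

theorem conv_comp_antipode_self (f : Character) : conv (f.comp antipode) f = counit := by
  refine algHom_ext_tree fun τ => ?_
  have h : conv antipode (.id ℝ BCK) (tree τ) = 0 := by
    change Algebra.TensorProduct.lmul' ℝ (Algebra.TensorProduct.map _ _ (coproduct (tree τ))) = 0
    rw [map_antipode_id_coproduct_tree, map_add, Algebra.TensorProduct.lmul'_apply_tmul, mul_one,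
      antipode_tree_eq_neg_lmul_cutSum, neg_add_cancel]
  rw [counit_tree, ← map_zero f, ← h, ← AlgHom.comp_apply, comp_conv, AlgHom.comp_id]

theorem comp_antipode_eq {f g : Character} (h : conv f g = counit) : f.comp antipode = g := by
  rw [← conv_counit (f.comp antipode), ← h, ← conv_assoc, conv_comp_antipode_self, counit_conv]

theorem conv_self_comp_antipode (f : Character) : conv f (f.comp antipode) = counit := by
  have h := conv_comp_antipode_self (f.comp antipode)
  rwa [comp_antipode_eq (conv_comp_antipode_self f)] at h

theorem conv_tree {A : Type} [CommRing A] [Algebra ℝ A] (f g : BCK →ₐ[ℝ] A) (τ : RTree) :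
    conv f g (tree τ) = f (tree τ) + g (tree τ) +
      (τ.properCuts.map fun c => f (forest c.1) * g (tree c.2)).sum := by
  change Algebra.TensorProduct.lmul' ℝ (Algebra.TensorProduct.map f g (coproduct (tree τ))) = _
  rw [coproduct_tree, reducedCoproduct]
  simp [map_multiset_sum, Multiset.map_map, Function.comp_def]

/-! ### Antisymmetric order -/

/-- Two characters agree on all trees with at most `n` nodes. -/
def AgreeUpTo (n : ℕ) (f g : Character) : Prop :=
  ∀ τ : RTree, τ.size ≤ n → f (tree τ) = g (tree τ)

namespace AgreeUpTo

variable {n : ℕ} {f f' g g' : Character}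

theorem refl (n : ℕ) (f : Character) : AgreeUpTo n f f := fun _ _ => rfl

theorem symm (h : AgreeUpTo n f g) : AgreeUpTo n g f := fun τ hτ => (h τ hτ).symm

theorem mono {m : ℕ} (hmn : m ≤ n) (h : AgreeUpTo n f g) : AgreeUpTo m f g :=
  fun τ hτ => h τ (hτ.trans hmn)

theorem sum_properCuts (hf : AgreeUpTo n f f') (hg : AgreeUpTo n g g') {τ : RTree}
    (hτ : τ.size ≤ n + 1) :
    (τ.properCuts.map fun c => f (forest c.1) * g (tree c.2)).sum =
      (τ.properCuts.map fun c => f' (forest c.1) * g' (tree c.2)).sum := by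
  congr 1
  refine Multiset.map_congr rfl fun c hc => ?_
  obtain ⟨hP, hR⟩ := RTree.size_lt_of_mem_properCuts hc
  rw [map_forest_congr fun σ hσ => hf σ (Nat.le_of_lt_succ ((hP σ hσ).trans_le hτ)),
    hg c.2 (Nat.le_of_lt_succ (hR.trans_le hτ))]

theorem conv (hf : AgreeUpTo n f f') (hg : AgreeUpTo n g g') :
    AgreeUpTo n (conv f g) (conv f' g') := by
  intro τ hτ
  rw [conv_tree, conv_tree, hf τ hτ, hg τ hτ, sum_properCuts hf hg (hτ.trans n.le_succ)]

theorem of_conv_self (h : AgreeUpTo n (BCK.conv f f) (BCK.conv g g)) : AgreeUpTo n f g := by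
  induction n with
  | zero => exact fun τ hτ => absurd τ.size_pos hτ.not_gt
  | succ n ih =>
    have hn := ih (h.mono n.le_succ)
    intro τ hτ
    have hτ' := h τ hτ
    rw [conv_tree, conv_tree, sum_properCuts hn hn hτ] at hτ'
    linarith

end AgreeUpTo

theorem conv_comp_minus_self (ψ : Character) :
    conv (ψ.comp minus) (ψ.comp minus) = conv (ψ.comp antipodeBar) ψ := by
  have h : ψ.comp minus = (conv (ψ.comp antipodeBar) ψ).comp sqrtId := by
    rw [minus, ← AlgHom.comp_assoc, comp_conv, AlgHom.comp_id]
  rw [h, ← comp_conv, conv_sqrtId_sqrtId, AlgHom.comp_id]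

theorem comp_plus (ψ : Character) :
    ψ.comp plus = conv ψ ((ψ.comp minus).comp antipode) := by
  rw [plus, comp_conv, AlgHom.comp_id, AlgHom.comp_assoc]

theorem agreeUpTo_comp_minus_iff {n : ℕ} {ψ : Character} :
    AgreeUpTo n ψ (ψ.comp minus) ↔ AgreeUpTo n ψ (ψ.comp antipodeBar) := by
  constructor <;> intro h
  · have h_conv := (h.conv h).conv (AgreeUpTo.refl n (ψ.comp antipode))
    rwa [conv_comp_minus_self, conv_assoc, conv_self_comp_antipode, conv_counit, conv_assoc,
      conv_self_comp_antipode, conv_counit] at h_conv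
  · refine AgreeUpTo.of_conv_self ?_
    rw [conv_comp_minus_self]
    exact h.conv (AgreeUpTo.refl n ψ)

theorem plus_eq_zero_iff_agreeUpTo {n : ℕ} {ψ : Character} :
    (∀ τ : RTree, τ.size ≤ n → ψ (plus (tree τ)) = 0) ↔
      AgreeUpTo n ψ (ψ.comp antipodeBar) := by
  have h_plus : (∀ τ : RTree, τ.size ≤ n → ψ (plus (tree τ)) = 0) ↔
      AgreeUpTo n (conv ψ ((ψ.comp minus).comp antipode)) counit := by
    simp only [← comp_plus, AgreeUpTo, counit_tree, AlgHom.comp_apply]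
  rw [h_plus, ← agreeUpTo_comp_minus_iff]
  constructor <;> intro h
  · have h_conv := h.conv (AgreeUpTo.refl n (ψ.comp minus))
    rwa [conv_assoc, conv_comp_antipode_self, conv_counit, counit_conv] at h_conv
  · have h_conv := h.conv (AgreeUpTo.refl n ((ψ.comp minus).comp antipode))
    rwa [conv_self_comp_antipode] at h_conv

theorem involution_forest (F : Forest) :
    involution (forest F) = (-1 : ℝ) ^ (F.map RTree.size).sum • forest F := by
  induction F using Multiset.induction with
  | empty => simp [forest_zero]
  | cons τ F ih =>
    rw [← Multiset.singleton_add, forest_add, map_mul, ih, forest_singleton]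
    simp [involution, tree, pow_add, Algebra.smul_def, mul_mul_mul_comm]

theorem involution_tree (τ : RTree) : involution (tree τ) = (-1 : ℝ) ^ τ.size • tree τ := by
  simpa [forest_singleton] using involution_forest {τ}

theorem involution_comp_involution : involution.comp involution = AlgHom.id ℝ BCK :=
  algHom_ext_tree fun τ => by
    simp [involution_tree, smul_smul, ← pow_add, ← two_mul]

theorem involution_graft (x : BCK) : involution (graft x) = -graft (involution x) := by
  have h : involution.toLinearMap ∘ₗ graft = -(graft ∘ₗ involution.toLinearMap) := by
    refine linearMap_ext_forest fun F => ?_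
    simp [graft_forest, involution_forest, involution_tree, RTree.size_node, pow_add]
  exact LinearMap.congr_fun h x

theorem conv_comp_involution {A : Type} [CommRing A] [Algebra ℝ A] (f g : BCK →ₐ[ℝ] A) :
    (conv f g).comp involution = conv (f.comp involution) (g.comp involution) := by
  refine algHom_ext_tree fun τ => ?_
  simp only [AlgHom.comp_apply, conv_tree, involution_tree, involution_forest, map_smul, smul_add,
    Multiset.smul_sum, Multiset.map_map, Function.comp_def, smul_mul_smul_comm, ← pow_add]
  congr 2
  refine Multiset.map_congr rfl fun c hc => ?_
  rw [RTree.size_of_mem_admissibleCuts]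
  rw [RTree.admissibleCuts_eq]
  exact Multiset.mem_cons_of_mem hc

theorem counit_comp_involution : counit.comp involution = counit :=
  algHom_ext_tree fun τ => by simp [involution_tree, counit_tree]

theorem AgreeUpTo.comp_involution {n : ℕ} {f g : Character} (h : AgreeUpTo n f g) :
    AgreeUpTo n (f.comp involution) (g.comp involution) := fun τ hτ => by
  simp only [AlgHom.comp_apply, involution_tree, map_smul, h τ hτ]

/-- The trees with `n + 1` nodes occur in `ψ * (ψ ∘ S) = counit` and in
`(ψ ∘ S̄) * (ψ ∘ involution) = counit` with the same lower order terms. -/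
theorem AgreeUpTo.succ_of_even {n : ℕ} {ψ : Character} (hn : Even n)
    (h : AgreeUpTo n ψ (ψ.comp antipodeBar)) : AgreeUpTo (n + 1) ψ (ψ.comp antipodeBar) := by
  intro τ hτ
  rcases hτ.lt_or_eq with hlt | heq
  · exact h τ (Nat.le_of_lt_succ hlt)
  set χ := ψ.comp antipodeBar with hχ
  have hψ : BCK.conv ψ (χ.comp involution) = counit := by
    rw [hχ, antipodeBar, ← AlgHom.comp_assoc, AlgHom.comp_assoc, involution_comp_involution,
      AlgHom.comp_id, conv_self_comp_antipode]
  have hχ_conv : BCK.conv χ (ψ.comp involution) = counit := by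
    rw [hχ, antipodeBar, ← AlgHom.comp_assoc, ← conv_comp_involution, conv_comp_antipode_self,
      counit_comp_involution]
  have eψ := AlgHom.congr_fun hψ (tree τ)
  have eχ := AlgHom.congr_fun hχ_conv (tree τ)
  rw [conv_tree, h.sum_properCuts h.symm.comp_involution hτ] at eψ
  rw [conv_tree] at eχ
  simp only [counit_tree, AlgHom.comp_apply, involution_tree, map_smul, heq,
    hn.add_one.neg_one_pow, smul_eq_mul] at eψ eχ
  linarith

theorem conv_graft {A B : Type} [CommRing A] [Algebra ℝ A] [CommRing B] [Algebra ℝ B]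
    (χ : Character) {f : BCK →ₐ[ℝ] A} {g : BCK →ₐ[ℝ] B} {Λ : A →ₗ[ℝ] B}
    (hg : ∀ x, g (graft x) = Λ (f x)) (x : BCK) :
    conv ((Algebra.ofId ℝ B).comp χ) g (graft x) =
      algebraMap ℝ B (χ (graft x)) + Λ (conv ((Algebra.ofId ℝ A).comp χ) f x) := by
  simp only [conv, AlgHom.comp_apply, coproduct_graft, map_add, Algebra.TensorProduct.map_tmul,
    map_one, Algebra.TensorProduct.lmul'_apply_tmul, mul_one]
  congr 1
  induction coproduct x using TensorProduct.induction_on with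
  | zero => simp
  | add a b ha hb => simp only [map_add, ha, hb]
  | tmul a b => simp [hg, Algebra.ofId_apply, ← Algebra.smul_def]

end BCK

open BCK

/-! ### Internal weights of small forests -/

section Filtration

variable {R : Type*} [CommRing R] [Algebra ℝ R] {U : BCK →ₐ[ℝ] R} {Λ : R →ₗ[ℝ] R}

theorem map_forest_mem_filtration {Fil : ℕ → Submodule ℝ R} {N : ℕ}
    (hmul : ∀ i j, i + j ≤ N → Fil i * Fil j ≤ Fil (i + j)) {F : Forest}
    (hF : F ≠ 0) (hN : (F.map RTree.size).sum ≤ N)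
    (h : ∀ τ ∈ F, U (tree τ) ∈ Fil τ.size) : U (forest F) ∈ Fil (F.map RTree.size).sum := by
  induction F using Multiset.induction with
  | empty => exact absurd rfl hF
  | cons τ F ih =>
    have hτ := h τ (Multiset.mem_cons_self _ _)
    rw [← Multiset.singleton_add, forest_add, forest_singleton, map_mul]
    rw [Multiset.map_cons, Multiset.sum_cons] at hN
    rw [Multiset.singleton_add, Multiset.map_cons, Multiset.sum_cons]
    rcases eq_or_ne F 0 with rfl | hF
    · simpa [forest_zero] using hτ
    · exact hmul _ _ hN (Submodule.mul_mem_mul hτ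
        (ih hF (by omega) fun σ hσ => h σ (Multiset.mem_cons_of_mem hσ)))

theorem map_tree_mem_filtration (hU : ∀ x, U (graft x) = Λ (U x)) {Fil : ℕ → Submodule ℝ R}
    {N : ℕ} (h_one : Λ 1 ∈ Fil 1) (hmul : ∀ i j, i + j ≤ N → Fil i * Fil j ≤ Fil (i + j))
    (hΛ : ∀ i < N, (Fil i).map Λ ≤ Fil (i + 1)) {τ : RTree} (hτ : τ.size ≤ N) :
    U (tree τ) ∈ Fil τ.size := by
  induction τ using RTree.induction with
  | h F ih =>
    rw [← graft_forest, hU, RTree.size_node]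
    rcases eq_or_ne F 0 with rfl | hF
    · simpa [forest_zero] using h_one
    rw [RTree.size_node] at hτ
    rw [add_comm]
    refine hΛ _ (by omega) (Submodule.mem_map_of_mem ?_)
    refine map_forest_mem_filtration hmul hF (by omega) fun σ hσ => ih σ hσ ?_
    exact (RTree.size_lt_of_mem hσ).le.trans (by rwa [RTree.size_node])

/-- The filtration spanned by sets of generators of given degrees. -/
def degreeFiltration (G : ℕ → Set R) (n : ℕ) : Submodule ℝ R := .span ℝ (⋃ i ≤ n, G i)

theorem degreeFiltration_mono (G : ℕ → Set R) : Monotone (degreeFiltration G) := fun _ _ hmn =>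
  Submodule.span_mono (Set.biUnion_mono (fun _ hi => le_trans hi hmn) fun _ _ => le_rfl)

theorem mem_degreeFiltration {G : ℕ → Set R} {i n : ℕ} (hi : i ≤ n) {x : R} (hx : x ∈ G i) :
    x ∈ degreeFiltration G n :=
  Submodule.subset_span (Set.mem_biUnion hi hx)

theorem degreeFiltration_mul_le {G : ℕ → Set R} {N : ℕ}
    (h : ∀ i j, i + j ≤ N → ∀ x ∈ G i, ∀ y ∈ G j, x * y ∈ degreeFiltration G (i + j))
    {i j : ℕ} (hij : i + j ≤ N) :
    degreeFiltration G i * degreeFiltration G j ≤ degreeFiltration G (i + j) := by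
  rw [degreeFiltration, degreeFiltration, Submodule.span_mul_span, Submodule.span_le,
    Set.mul_subset_iff]
  intro x hx y hy
  obtain ⟨i', hi, hx⟩ := Set.mem_iUnion₂.1 hx
  obtain ⟨j', hj, hy⟩ := Set.mem_iUnion₂.1 hy
  exact degreeFiltration_mono G (add_le_add hi hj)
    (h i' j' ((add_le_add hi hj).trans hij) x hx y hy)

theorem map_degreeFiltration_le {G : ℕ → Set R} {N : ℕ}
    (h : ∀ i < N, ∀ x ∈ G i, Λ x ∈ degreeFiltration G (i + 1)) {i : ℕ} (hi : i < N) :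
    (degreeFiltration G i).map Λ ≤ degreeFiltration G (i + 1) := by
  rw [degreeFiltration, Submodule.map_span_le]
  intro x hx
  obtain ⟨i', hi', hx⟩ := Set.mem_iUnion₂.1 hx
  exact degreeFiltration_mono G (Nat.succ_le_succ hi') (h i' (hi'.trans_lt hi) x hx)

/-- The relations between the internal weights `c`, `d`, `g`, `h` of the first four tall trees that
allow to reduce the weights of all trees with at most six nodes to finitely many of them. -/
structure TallTreeRelations (Λ : R →ₗ[ℝ] R) (c d g h : R) (k μ κ ρ : ℝ) : Prop where
  map_one : Λ 1 = c
  map_c : Λ c = d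
  map_d : Λ d = g
  map_g : Λ g = h
  c_mul_c : c * c = k • c + μ • d
  c_mul_d : c * d = κ • d + ρ • g
  μ_ne_zero : μ ≠ 0

/-- Generators for the internal weights of the forests with at most five nodes, by the number of
nodes, under `TallTreeRelations`. -/
def weightGenerators (Λ : R →ₗ[ℝ] R) (c d g h : R) : ℕ → Set R
  | 1 => {c}
  | 2 => {d}
  | 3 => {g}
  | 4 => {h, c * g}
  | 5 => {Λ h, Λ (c * g), c * h, c * (c * g)}
  | _ => ∅

namespace TallTreeRelations

variable {c d g h : R} {k μ κ ρ : ℝ}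

theorem d_mul_d (H : TallTreeRelations Λ c d g h k μ κ ρ) :
    d * d = μ⁻¹ • ((κ - k) • (κ • d + ρ • g) + ρ • (c * g)) := by
  have h_assoc : (c * c) * d = c * (c * d) := mul_assoc c c d
  rw [H.c_mul_c, add_mul, smul_mul_assoc, smul_mul_assoc] at h_assoc
  conv_rhs at h_assoc => rw [H.c_mul_d, mul_add, mul_smul_comm, mul_smul_comm]
  rw [eq_inv_smul_iff₀ H.μ_ne_zero, ← H.c_mul_d, sub_smul]
  linear_combination h_assoc

theorem d_mul_g (H : TallTreeRelations Λ c d g h k μ κ ρ) :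
    d * g = μ⁻¹ • (c * (c * g) - k • (c * g)) := by
  rw [eq_inv_smul_iff₀ H.μ_ne_zero, ← mul_assoc, H.c_mul_c, add_mul, smul_mul_assoc,
    smul_mul_assoc, add_sub_cancel_left]

theorem mul_mem (H : TallTreeRelations Λ c d g h k μ κ ρ) {i j : ℕ} (hij : i + j ≤ 5) {x y : R}
    (hx : x ∈ weightGenerators Λ c d g h i) (hy : y ∈ weightGenerators Λ c d g h j) :
    x * y ∈ degreeFiltration (weightGenerators Λ c d g h) (i + j) := by
  wlog h_le : i ≤ j generalizing i j x y
  · rw [mul_comm, add_comm]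
    exact this (by omega) hy hx (by omega)
  have hi : i ≠ 0 := fun e => by simp [e, weightGenerators] at hx
  have smul_gen_mem : ∀ {m n : ℕ} {z : R}, z ∈ weightGenerators Λ c d g h m → m ≤ n → ∀ a : ℝ,
      a • z ∈ degreeFiltration (weightGenerators Λ c d g h) n := fun hz hmn a =>
    Submodule.smul_mem _ a (mem_degreeFiltration hmn hz)
  have hc : c ∈ weightGenerators Λ c d g h 1 := rfl
  have hd : d ∈ weightGenerators Λ c d g h 2 := rfl
  have hg : g ∈ weightGenerators Λ c d g h 3 := rfl
  have hcg : c * g ∈ weightGenerators Λ c d g h 4 := .inr rfl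
  have hccg : c * (c * g) ∈ weightGenerators Λ c d g h 5 := .inr (.inr (.inr rfl))
  obtain ⟨rfl, rfl⟩ | ⟨rfl, rfl⟩ | ⟨rfl, rfl⟩ | ⟨rfl, rfl⟩ | ⟨rfl, rfl⟩ | ⟨rfl, rfl⟩ :
      (i = 1 ∧ j = 1) ∨ (i = 1 ∧ j = 2) ∨ (i = 1 ∧ j = 3) ∨ (i = 1 ∧ j = 4) ∨
      (i = 2 ∧ j = 2) ∨ (i = 2 ∧ j = 3) := by omega
  all_goals rw [Set.mem_singleton_iff.1 hx]
  · rw [Set.mem_singleton_iff.1 hy, H.c_mul_c]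
    exact add_mem (smul_gen_mem hc (by norm_num) k) (smul_gen_mem hd le_rfl μ)
  · rw [Set.mem_singleton_iff.1 hy, H.c_mul_d]
    exact add_mem (smul_gen_mem hd (by norm_num) κ) (smul_gen_mem hg le_rfl ρ)
  · rw [Set.mem_singleton_iff.1 hy]
    exact mem_degreeFiltration le_rfl hcg
  · obtain rfl | rfl := hy
    · exact mem_degreeFiltration le_rfl (.inr (.inr (.inl rfl)))
    · exact mem_degreeFiltration le_rfl hccg
  · rw [Set.mem_singleton_iff.1 hy, H.d_mul_d]
    exact Submodule.smul_mem _ _ (add_mem (Submodule.smul_mem _ _ (add_mem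
      (smul_gen_mem hd (by norm_num) κ) (smul_gen_mem hg (by norm_num) ρ)))
      (smul_gen_mem hcg le_rfl ρ))
  · rw [Set.mem_singleton_iff.1 hy, H.d_mul_g]
    exact Submodule.smul_mem _ _ (sub_mem (mem_degreeFiltration le_rfl hccg)
      (smul_gen_mem hcg (by norm_num) k))

theorem map_mem (H : TallTreeRelations Λ c d g h k μ κ ρ) {i : ℕ} (hi : i < 5) {x : R}
    (hx : x ∈ weightGenerators Λ c d g h i) :
    Λ x ∈ degreeFiltration (weightGenerators Λ c d g h) (i + 1) := by
  refine mem_degreeFiltration le_rfl ?_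
  interval_cases i
  · exact absurd hx (Set.notMem_empty x)
  · rw [Set.mem_singleton_iff.1 hx]
    exact H.map_c
  · rw [Set.mem_singleton_iff.1 hx]
    exact H.map_d
  · rw [Set.mem_singleton_iff.1 hx]
    exact .inl H.map_g
  · obtain rfl | rfl := hx
    · exact .inl rfl
    · exact .inr (.inl rfl)

theorem map_forest_mem (H : TallTreeRelations Λ c d g h k μ κ ρ)
    (hU : ∀ x, U (graft x) = Λ (U x)) {F : Forest} (hF : F ≠ 0)
    (hF5 : (F.map RTree.size).sum ≤ 5) :
    U (forest F) ∈ degreeFiltration (weightGenerators Λ c d g h) (F.map RTree.size).sum := by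
  have hmul : ∀ i j, i + j ≤ 5 → degreeFiltration (weightGenerators Λ c d g h) i *
      degreeFiltration (weightGenerators Λ c d g h) j ≤
        degreeFiltration (weightGenerators Λ c d g h) (i + j) :=
    fun _ _ => degreeFiltration_mul_le fun _ _ hij _ hx _ hy => H.mul_mem hij hx hy
  refine map_forest_mem_filtration hmul hF hF5 fun τ hτ => ?_
  refine map_tree_mem_filtration hU (mem_degreeFiltration le_rfl H.map_one) hmul
    (fun _ => map_degreeFiltration_le fun _ hi _ hx => H.map_mem hi hx) ?_
  exact (Multiset.single_le_sum (fun _ _ => Nat.zero_le _) _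
    (Multiset.mem_map_of_mem RTree.size hτ)).trans hF5

theorem map_forest_eq_zero (H : TallTreeRelations Λ c d g h k μ κ ρ)
    (hU : ∀ x, U (graft x) = Λ (U x)) {β : R →ₗ[ℝ] ℝ}
    (hβ : ∀ x ∈ ({c, d, g, h, c * g, Λ h, Λ (c * g), c * h, c * (c * g)} : Set R), β x = 0)
    {F : Forest} (hF : F ≠ 0) (hF5 : (F.map RTree.size).sum ≤ 5) : β (U (forest F)) = 0 := by
  have h_gen : ∀ i, weightGenerators Λ c d g h i ⊆ (LinearMap.ker β : Submodule ℝ R) := by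
    intro i x hx
    refine hβ x ?_
    rcases i with _ | _ | _ | _ | _ | _ | i <;>
      simp only [weightGenerators, Set.mem_insert_iff, Set.mem_singleton_iff,
        Set.mem_empty_iff_false] at hx ⊢ <;> tauto
  have h_le : degreeFiltration (weightGenerators Λ c d g h) (F.map RTree.size).sum ≤
      LinearMap.ker β :=
    Submodule.span_le.2 (Set.iUnion₂_subset fun i _ => h_gen i)
  exact h_le (H.map_forest_mem hU hF hF5)

end TallTreeRelations

end Filtration

theorem iSup_natCast_eq_iff {p : ℕ → Prop} (hp : Antitone p) {m : ℕ} (hm : 0 < m) :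
    (⨆ (n : ℕ) (_ : p n), (n : ℕ∞)) = m ↔ p m ∧ ¬ p (m + 1) := by
  constructor
  · intro h
    have h_le : ∀ n, p n → n ≤ m := fun n hn => by
      have h_cast : (n : ℕ∞) ≤ m := h ▸ le_iSup₂ (f := fun (n : ℕ) (_ : p n) => (n : ℕ∞)) n hn
      exact_mod_cast h_cast
    refine ⟨by_contra fun hpm => ?_, fun hp_succ => (h_le _ hp_succ).not_gt m.lt_succ_self⟩
    have h_pred : (m : ℕ∞) ≤ (m - 1 : ℕ) := h ▸ iSup₂_le fun n hn => by
      have h_ne : n ≠ m := fun e => hpm (e ▸ hn)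
      exact_mod_cast Nat.le_sub_one_of_lt ((h_le n hn).lt_of_ne h_ne)
    exact (Nat.sub_one_lt hm.ne').not_ge (by exact_mod_cast h_pred)
  · rintro ⟨hpm, hp_succ⟩
    refine le_antisymm (iSup₂_le fun n hn => ?_)
      (le_iSup₂ (f := fun (n : ℕ) (_ : p n) => (n : ℕ∞)) m hpm)
    exact_mod_cast not_lt.1 fun h => hp_succ (hp h hn)

namespace Character

/-- The character `ψ` has order at least `m`: it agrees with the exact flow on all trees with at
most `m` nodes. -/
def HasOrder (m : ℕ) (ψ : Character) : Prop :=
  ∀ τ : RTree, τ.size ≤ m → ψ (tree τ) = 1 / (τ.factorial : ℝ)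

theorem antitone_hasOrder (ψ : Character) : Antitone fun m => ψ.HasOrder m :=
  fun _ _ hmn h τ hτ => h τ (hτ.trans hmn)

theorem ord_eq_iff {ψ : Character} {m : ℕ} (hm : 0 < m) :
    ψ.ord = m ↔ ψ.HasOrder m ∧ ¬ ψ.HasOrder (m + 1) :=
  iSup_natCast_eq_iff ψ.antitone_hasOrder hm

theorem antisymOrd_eq_iff {ψ : Character} {m : ℕ} (hm : 0 < m) : ψ.antisymOrd = m ↔
    AgreeUpTo m ψ (ψ.comp antipodeBar) ∧ ¬ AgreeUpTo (m + 1) ψ (ψ.comp antipodeBar) := by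
  rw [← plus_eq_zero_iff_agreeUpTo, ← plus_eq_zero_iff_agreeUpTo]
  exact iSup_natCast_eq_iff
    (p := fun n => ∀ τ : RTree, τ.size ≤ n → ψ (plus (tree τ)) = 0)
    (fun _ _ hmn h τ hτ => h τ (hτ.trans hmn)) hm

end Character

namespace RTree

theorem sum_map_size_eq_zero_iff {F : Forest} : (F.map size).sum = 0 ↔ F = 0 := by
  refine ⟨fun h => Multiset.eq_zero_of_forall_notMem fun τ hτ => τ.size_pos.ne' ?_, ?_⟩
  · exact Multiset.sum_eq_zero_iff.1 h _ (Multiset.mem_map_of_mem size hτ)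
  · rintro rfl
    rfl

theorem size_eq_one_iff {τ : RTree} : τ.size = 1 ↔ τ = node 0 := by
  refine ⟨fun h => ?_, fun h => by simp [h, size_node]⟩
  obtain ⟨F, rfl⟩ := exists_eq_node τ
  rw [size_node] at h
  rw [sum_map_size_eq_zero_iff.1 (by omega : (F.map size).sum = 0)]

theorem size_eq_two_iff {τ : RTree} : τ.size = 2 ↔ τ = node {node 0} := by
  refine ⟨fun h => ?_, fun h => by simp [h, size_node]⟩
  obtain ⟨F, rfl⟩ := exists_eq_node τ
  rw [size_node] at h
  obtain ⟨σ, hσ⟩ := Multiset.exists_mem_of_ne_zero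
    (mt sum_map_size_eq_zero_iff.2 (by omega : (F.map size).sum ≠ 0))
  obtain ⟨G, rfl⟩ := Multiset.exists_cons_of_mem hσ
  rw [Multiset.map_cons, Multiset.sum_cons] at h
  have h_pos := σ.size_pos
  rw [sum_map_size_eq_zero_iff.1 (by omega : (G.map size).sum = 0),
    size_eq_one_iff.1 (by omega : σ.size = 1)]
  rfl

theorem factorial_node (F : Forest) :
    factorial (node F) = size (node F) * (F.map factorial).prod := by
  rw [size_node]
  conv_lhs => rw [factorial, recurse_node]
  simp only [Multiset.map_map, Function.comp_def]
  rfl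

/-- The tree with `n + 1` nodes that has no branching. -/
noncomputable def tall : ℕ → RTree
  | 0 => node 0
  | n + 1 => node {tall n}

theorem size_tall (n : ℕ) : (tall n).size = n + 1 := by
  induction n with
  | zero => simp [tall, size_node]
  | succ n ih => simp [tall, size_node, ih, add_comm]

end RTree

namespace RKScheme

/-! ### Elementary weights of the adjoint scheme -/

section

variable {n : ℕ}

/-- The internal weights `(ψ₁, …, ψₙ)`, as an algebra map into the functions of the stage. -/
noncomputable def stages (Ψ : RKScheme n) : BCK →ₐ[ℝ] (Fin n → ℝ) :=
  MvPolynomial.aeval fun τ => Ψ.A.mulVecLin (Ψ.derivativeWeight τ)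

/-- The quadrature functional `v ↦ ∑ᵢ bᵢ vᵢ`. -/
noncomputable def weight (Ψ : RKScheme n) : (Fin n → ℝ) →ₗ[ℝ] ℝ := dotProductBilin ℝ ℝ Ψ.b

theorem weight_apply (Ψ : RKScheme n) (v : Fin n → ℝ) : Ψ.weight v = ∑ i, Ψ.b i * v i := rfl

theorem stages_tree (Ψ : RKScheme n) (τ : RTree) :
    Ψ.stages (tree τ) = Ψ.A.mulVecLin (Ψ.derivativeWeight τ) := by
  simp [stages, tree]

theorem derivativeWeight_node (Ψ : RKScheme n) (F : Forest) :
    Ψ.derivativeWeight (RTree.node F) = Ψ.stages (forest F) := by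
  funext i
  rw [derivativeWeight, RTree.recurse_node, map_forest, Multiset.map_map, Pi.multiset_prod_apply,
    Multiset.map_map]
  simp only [Function.comp_def, stages_tree]
  rfl

theorem stages_graft (Ψ : RKScheme n) (x : BCK) :
    Ψ.stages (graft x) = Ψ.A.mulVecLin (Ψ.stages x) := by
  have h : Ψ.stages.toLinearMap ∘ₗ graft = Ψ.A.mulVecLin ∘ₗ Ψ.stages.toLinearMap :=
    linearMap_ext_forest fun F => by
      simp [graft_forest, stages_tree, derivativeWeight_node]
  exact LinearMap.congr_fun h x

theorem character_graft (Ψ : RKScheme n) (x : BCK) :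
    Ψ.character (graft x) = Ψ.weight (Ψ.stages x) := by
  have h : Ψ.character.toLinearMap ∘ₗ graft = Ψ.weight ∘ₗ Ψ.stages.toLinearMap :=
    linearMap_ext_forest fun F => by
      simp [graft_forest, ← derivativeWeight_node, character, tree, weight_apply]
  exact LinearMap.congr_fun h x

theorem stages_node (Ψ : RKScheme n) (F : Forest) :
    Ψ.stages (tree (RTree.node F)) = Ψ.A.mulVecLin (Ψ.stages (forest F)) := by
  rw [← graft_forest, stages_graft]

theorem character_node (Ψ : RKScheme n) (F : Forest) :
    Ψ.character (tree (RTree.node F)) = Ψ.weight (Ψ.stages (forest F)) := by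
  rw [← graft_forest, character_graft]

/-- The scheme with all coefficients negated, whose characters are those of `Ψ` twisted by the sign
`(-1) ^ |τ|`. -/
def negate (Ψ : RKScheme n) : RKScheme n := ⟨-Ψ.A, -Ψ.b⟩

/-- The scheme of the inverse step, whose character is the inverse of that of `Ψ` for the
convolution product. -/
def inverse (Ψ : RKScheme n) : RKScheme n := ⟨Ψ.A - Matrix.of fun _ => Ψ.b, -Ψ.b⟩

/-- The adjoint scheme, the inverse of the step in reversed time. -/
def adjoint (Ψ : RKScheme n) : RKScheme n := Ψ.inverse.negate

theorem mulVecLin_negate (Ψ : RKScheme n) : Ψ.negate.A.mulVecLin = -Ψ.A.mulVecLin := by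
  ext; simp [negate]

theorem weight_negate (Ψ : RKScheme n) : Ψ.negate.weight = -Ψ.weight := by
  ext; simp [negate, weight_apply]

theorem stages_negate (Ψ : RKScheme n) : Ψ.negate.stages = Ψ.stages.comp involution :=
  algHom_ext_graft fun F ih => by
    rw [stages_graft, ih, AlgHom.comp_apply, AlgHom.comp_apply, involution_graft, map_neg,
      stages_graft, mulVecLin_negate, LinearMap.neg_apply]

theorem character_negate (Ψ : RKScheme n) :
    Ψ.negate.character = Ψ.character.comp involution :=
  algHom_ext_graft fun F _ => by
    rw [character_graft, stages_negate, AlgHom.comp_apply, AlgHom.comp_apply, involution_graft,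
      map_neg, character_graft, weight_negate, LinearMap.neg_apply]

theorem mulVecLin_inverse (Ψ : RKScheme n) (v : Fin n → ℝ) :
    Ψ.inverse.A.mulVecLin v = Ψ.A.mulVecLin v - Ψ.weight v • 1 := by
  ext i; simp [inverse, weight_apply, Matrix.mulVec, dotProduct]

theorem weight_inverse (Ψ : RKScheme n) : Ψ.inverse.weight = -Ψ.weight := by
  ext; simp [inverse, weight_apply]

theorem conv_character_stages_inverse (Ψ : RKScheme n) :
    conv ((Algebra.ofId ℝ _).comp Ψ.character) Ψ.inverse.stages = Ψ.stages :=
  algHom_ext_graft fun F ih => by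
    rw [conv_graft _ Ψ.inverse.stages_graft, ih, mulVecLin_inverse, character_graft, stages_graft,
      Algebra.algebraMap_eq_smul_one, add_sub_cancel]

theorem conv_character_inverse (Ψ : RKScheme n) :
    conv Ψ.character Ψ.inverse.character = counit :=
  algHom_ext_graft fun F _ => by
    have h := conv_graft Ψ.character Ψ.inverse.character_graft (forest F)
    rw [conv_character_stages_inverse, character_graft, weight_inverse, LinearMap.neg_apply] at h
    rw [graft_forest, counit_tree, ← graft_forest]
    exact h.trans (add_neg_cancel _)

theorem character_comp_antipodeBar (Ψ : RKScheme n) :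
    Ψ.character.comp antipodeBar = Ψ.adjoint.character := by
  rw [antipodeBar, ← AlgHom.comp_assoc, comp_antipode_eq Ψ.conv_character_inverse,
    ← character_negate, adjoint]

theorem mulVecLin_adjoint (Ψ : RKScheme n) (v : Fin n → ℝ) :
    Ψ.adjoint.A.mulVecLin v = Ψ.weight v • 1 - Ψ.A.mulVecLin v := by
  rw [adjoint, mulVecLin_negate, LinearMap.neg_apply, mulVecLin_inverse, neg_sub]

theorem weight_adjoint (Ψ : RKScheme n) : Ψ.adjoint.weight = Ψ.weight := by
  rw [adjoint, weight_negate, weight_inverse, neg_neg]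

theorem hasOrder_two_iff {Ψ : RKScheme n} : Ψ.character.HasOrder 2 ↔
    Ψ.weight 1 = 1 ∧ Ψ.weight (Ψ.A.mulVecLin 1) = 1 / 2 := by
  have h_dot : Ψ.character (tree (RTree.node 0)) = Ψ.weight 1 := by
    rw [character_node, forest_zero, map_one]
  have h_ladder : Ψ.character (tree (RTree.node {RTree.node 0})) = Ψ.weight (Ψ.A.mulVecLin 1) := by
    rw [character_node, forest_singleton, stages_node, forest_zero, map_one]
  constructor
  · intro h
    have e_dot := h (RTree.node 0) (by simp [RTree.size_node])
    have e_ladder := h (RTree.node {RTree.node 0}) (by simp [RTree.size_node])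
    rw [h_dot] at e_dot
    rw [h_ladder] at e_ladder
    exact ⟨by simpa [RTree.factorial_node, RTree.size_node] using e_dot,
      by simpa [RTree.factorial_node, RTree.size_node] using e_ladder⟩
  · rintro ⟨e_dot, e_ladder⟩ τ hτ
    obtain hτ | hτ : τ.size = 1 ∨ τ.size = 2 := by
      have := τ.size_pos
      omega
    · rw [RTree.size_eq_one_iff.1 hτ, h_dot, e_dot]
      simp [RTree.factorial_node, RTree.size_node]
    · rw [RTree.size_eq_two_iff.1 hτ, h_ladder, e_ladder]
      simp [RTree.factorial_node, RTree.size_node]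

theorem agreeUpTo_seven_adjoint_iff {Ψ : RKScheme n} :
    AgreeUpTo 7 Ψ.character Ψ.adjoint.character ↔
      AgreeUpTo 6 Ψ.character Ψ.adjoint.character := by
  rw [← character_comp_antipodeBar]
  exact ⟨fun h => h.mono (by norm_num), fun h => h.succ_of_even (by decide)⟩

theorem isEES_two_seven_iff {Ψ : RKScheme n} : Ψ.IsEES 2 7 ↔ Ψ.IsExplicit ∧
    (Ψ.character.HasOrder 2 ∧ ¬ Ψ.character.HasOrder 3) ∧
    AgreeUpTo 6 Ψ.character Ψ.adjoint.character ∧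
    ¬ AgreeUpTo 8 Ψ.character Ψ.adjoint.character := by
  rw [IsEES, Character.ord_eq_iff two_pos, Character.antisymOrd_eq_iff (by norm_num),
    character_comp_antipodeBar, agreeUpTo_seven_adjoint_iff]

end

/-! ### Sufficient relations -/

section

variable {n : ℕ} {Ψ : RKScheme n} {c d g : Fin n → ℝ}

theorem stages_tall (Ψ : RKScheme n) (m : ℕ) :
    Ψ.stages (tree (RTree.tall m)) = (Ψ.A.mulVecLin)^[m + 1] 1 := by
  induction m with
  | zero => simp [RTree.tall, stages_node, forest_zero]
  | succ m ih =>
    rw [RTree.tall, stages_node, forest_singleton, ih, Function.iterate_succ_apply' _ (m + 1)]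

theorem character_tall (Ψ : RKScheme n) (m : ℕ) :
    Ψ.character (tree (RTree.tall m)) = Ψ.weight ((Ψ.A.mulVecLin)^[m] 1) := by
  cases m with
  | zero => simp [RTree.tall, character_node, forest_zero]
  | succ m => rw [RTree.tall, character_node, forest_singleton, stages_tall]

/-- The internal weights of the tall trees with one, two and three nodes are `c`, `d` and `g`, and
those of the tall tree with four nodes vanish. -/
structure TallStages (Ψ : RKScheme n) (c d g : Fin n → ℝ) : Prop where
  mulVecLin_one : Ψ.A.mulVecLin 1 = c
  mulVecLin_c : Ψ.A.mulVecLin c = d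
  mulVecLin_d : Ψ.A.mulVecLin d = g
  mulVecLin_g : Ψ.A.mulVecLin g = 0

/-- The relations between the internal weights `c`, `d`, `g` of the tall trees that characterize the
explicit four-stage schemes in EES(2,7); here `s` is a square root of `2` and `k` is the second
abscissa of the scheme. -/
structure IsEffectivelySymmetric (Ψ : RKScheme n) (s k : ℝ) (c d g : Fin n → ℝ) : Prop
    extends TallStages Ψ c d g where
  sq_eq_two : s ^ 2 = 2
  k_ne_one : k ≠ 1
  c_mul_c : c * c = k • c - (2 * (k - 1)) • d
  c_mul_d : c * d = (s * k - s / 2 + 1) • d - ((1 + s) * (2 * k - 1)) • g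
  c_mul_g : c * g = (k + s / 2) • g
  weight_one : Ψ.weight 1 = 1
  weight_c : Ψ.weight c = 1 / 2
  weight_d : Ψ.weight d = (2 - s) / 4
  weight_g : Ψ.weight g = (3 - 2 * s) / 8

/-- The linear combination of `1, c, d, g` with the given coefficients. -/
def comb (c d g : Fin n → ℝ) (x₀ x₁ x₂ x₃ : ℝ) : Fin n → ℝ :=
  x₀ • 1 + x₁ • c + x₂ • d + x₃ • g

section Comb

local notation "⟪" x₀ "," x₁ "," x₂ "," x₃ "⟫" => comb c d g x₀ x₁ x₂ x₃

theorem comb_congr {x₀ x₁ x₂ x₃ y₀ y₁ y₂ y₃ : ℝ} (h₀ : x₀ = y₀) (h₁ : x₁ = y₁) (h₂ : x₂ = y₂)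
    (h₃ : x₃ = y₃) : ⟪x₀, x₁, x₂, x₃⟫ = ⟪y₀, y₁, y₂, y₃⟫ := by
  rw [h₀, h₁, h₂, h₃]

variable (c d g) in
theorem one_eq_comb : (1 : Fin n → ℝ) = ⟪1, 0, 0, 0⟫ := by
  simp [comb]

theorem comb_add (x₀ x₁ x₂ x₃ y₀ y₁ y₂ y₃ : ℝ) :
    ⟪x₀, x₁, x₂, x₃⟫ + ⟪y₀, y₁, y₂, y₃⟫ = ⟪x₀ + y₀, x₁ + y₁, x₂ + y₂, x₃ + y₃⟫ := by
  simp only [comb]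
  module

theorem comb_sub (x₀ x₁ x₂ x₃ y₀ y₁ y₂ y₃ : ℝ) :
    ⟪x₀, x₁, x₂, x₃⟫ - ⟪y₀, y₁, y₂, y₃⟫ = ⟪x₀ - y₀, x₁ - y₁, x₂ - y₂, x₃ - y₃⟫ := by
  simp only [comb]
  module

theorem smul_comb (r x₀ x₁ x₂ x₃ : ℝ) :
    r • ⟪x₀, x₁, x₂, x₃⟫ = ⟪r * x₀, r * x₁, r * x₂, r * x₃⟫ := by
  simp only [comb]
  module

theorem TallStages.mulVecLin_comb (H : Ψ.TallStages c d g) (x₀ x₁ x₂ x₃ : ℝ) :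
    Ψ.A.mulVecLin ⟪x₀, x₁, x₂, x₃⟫ = ⟪0, x₀, x₁, x₂⟫ := by
  simp only [comb, map_add, map_smul, H.mulVecLin_one, H.mulVecLin_c, H.mulVecLin_d,
    H.mulVecLin_g]
  module

namespace IsEffectivelySymmetric

variable {s k : ℝ}

theorem weight_comb (H : Ψ.IsEffectivelySymmetric s k c d g) (x₀ x₁ x₂ x₃ : ℝ) :
    Ψ.weight ⟪x₀, x₁, x₂, x₃⟫ = x₀ + x₁ / 2 + x₂ * ((2 - s) / 4) + x₃ * ((3 - 2 * s) / 8) := by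
  simp only [comb, map_add, map_smul, smul_eq_mul, H.weight_one, H.weight_c, H.weight_d,
    H.weight_g]
  ring

theorem mulVecLin_adjoint_comb (H : Ψ.IsEffectivelySymmetric s k c d g) (x₀ x₁ x₂ x₃ : ℝ) :
    Ψ.adjoint.A.mulVecLin ⟪x₀, x₁, x₂, x₃⟫ =
      ⟪x₀ + x₁ / 2 + x₂ * ((2 - s) / 4) + x₃ * ((3 - 2 * s) / 8), -x₀, -x₁, -x₂⟫ := by
  rw [mulVecLin_adjoint, H.weight_comb, H.mulVecLin_comb, one_eq_comb c d g, smul_comb, comb_sub]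
  exact comb_congr (by ring) (by ring) (by ring) (by ring)

theorem mul_comb (H : Ψ.IsEffectivelySymmetric s k c d g) (x₀ x₁ x₂ x₃ : ℝ) :
    ⟪0, 1, 0, 0⟫ * ⟪x₀, x₁, x₂, x₃⟫ =
      ⟪0, x₀ + x₁ * k, (s * k - s / 2 + 1) * x₂ - 2 * (k - 1) * x₁,
        (k + s / 2) * x₃ - (1 + s) * (2 * k - 1) * x₂⟫ := by
  have h_one_comb : ⟪0, 1, 0, 0⟫ = c := by simp [comb]
  rw [h_one_comb]
  simp only [comb, mul_add, mul_smul_comm, mul_one, H.c_mul_c, H.c_mul_d, H.c_mul_g]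
  module

theorem adjoint_mul_comb (H : Ψ.IsEffectivelySymmetric s k c d g) (x₀ x₁ x₂ x₃ : ℝ) :
    ⟪1, -1, 0, 0⟫ * ⟪x₀, x₁, x₂, x₃⟫ =
      ⟪x₀, x₁ - (x₀ + x₁ * k), x₂ - ((s * k - s / 2 + 1) * x₂ - 2 * (k - 1) * x₁),
        x₃ - ((k + s / 2) * x₃ - (1 + s) * (2 * k - 1) * x₂)⟫ := by
  have h_sub : ⟪1, -1, 0, 0⟫ = 1 - ⟪0, 1, 0, 0⟫ := by
    simp only [comb]
    module
  rw [h_sub, sub_mul, one_mul, H.mul_comb, comb_sub, sub_zero]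

theorem tallTreeRelations (H : Ψ.IsEffectivelySymmetric s k c d g) :
    TallTreeRelations (Ψ.A.mulVecLin.prodMap Ψ.adjoint.A.mulVecLin)
      (⟪0, 1, 0, 0⟫, ⟪1, -1, 0, 0⟫) (⟪0, 0, 1, 0⟫, ⟪1 / 2, -1, 1, 0⟫)
      (⟪0, 0, 0, 1⟫, ⟪(2 - s) / 4, -1 / 2, 1, -1⟫)
      (⟪0, 0, 0, 0⟫, ⟪(3 - 2 * s) / 8, -(2 - s) / 4, 1 / 2, -1⟫)
      k (-2 * (k - 1)) (s * k - s / 2 + 1) (-(1 + s) * (2 * k - 1)) := by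
  have hs := H.sq_eq_two
  constructor
  case μ_ne_zero => exact mul_ne_zero (by norm_num) (sub_ne_zero.2 H.k_ne_one)
  case c_mul_c | c_mul_d =>
    simp only [Prod.mk_mul_mk, Prod.smul_mk, Prod.mk_add_mk, H.mul_comb, H.adjoint_mul_comb,
      smul_comb, comb_add]
    refine Prod.ext (comb_congr ?_ ?_ ?_ ?_) (comb_congr ?_ ?_ ?_ ?_) <;> grind
  all_goals
    simp only [← Prod.mk_one_one, one_eq_comb c d g, LinearMap.prodMap_apply, H.mulVecLin_comb,
      H.mulVecLin_adjoint_comb]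
    refine Prod.ext (comb_congr ?_ ?_ ?_ ?_) (comb_congr ?_ ?_ ?_ ?_) <;> grind

theorem weight_stages_eq (H : Ψ.IsEffectivelySymmetric s k c d g) (F : Forest)
    (hF : (F.map RTree.size).sum ≤ 5) :
    Ψ.weight (Ψ.stages (forest F)) = Ψ.weight (Ψ.adjoint.stages (forest F)) := by
  rcases eq_or_ne F 0 with rfl | hF_ne
  · simp [forest_zero]
  let β : ((Fin n → ℝ) × (Fin n → ℝ)) →ₗ[ℝ] ℝ :=
    Ψ.weight ∘ₗ LinearMap.fst ℝ _ _ - Ψ.weight ∘ₗ LinearMap.snd ℝ _ _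
  refine sub_eq_zero.1 (H.tallTreeRelations.map_forest_eq_zero
    (U := Ψ.stages.prod Ψ.adjoint.stages) (β := β) (fun x => by simp [stages_graft]) ?_ hF_ne hF)
  have hs := H.sq_eq_two
  have hβ (v w : Fin n → ℝ) : β (v, w) = Ψ.weight v - Ψ.weight w := rfl
  simp only [Set.mem_insert_iff, Set.mem_singleton_iff, forall_eq_or_imp, forall_eq,
    Prod.mk_mul_mk, LinearMap.prodMap_apply, H.mul_comb, H.adjoint_mul_comb, H.mulVecLin_comb,
    H.mulVecLin_adjoint_comb, hβ, H.weight_comb]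
  refine ⟨?_, ?_, ?_, ?_, ?_, ?_, ?_, ?_, ?_⟩ <;> grind

theorem isEES (H : Ψ.IsEffectivelySymmetric s k c d g) (h_expl : Ψ.IsExplicit) :
    Ψ.IsEES 2 7 := by
  have hs := H.sq_eq_two
  refine isEES_two_seven_iff.2 ⟨h_expl, ⟨hasOrder_two_iff.2 ⟨H.weight_one, ?_⟩, ?_⟩, ?_, ?_⟩
  · rw [H.mulVecLin_one, H.weight_c]
  · intro h
    have h_factorial : (RTree.tall 2).factorial = 6 := by
      simp [RTree.tall, RTree.factorial_node, RTree.size_node]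
    have h_weight_d := h (RTree.tall 2) (by rw [RTree.size_tall])
    rw [character_tall, h_factorial, Function.iterate_succ_apply', Function.iterate_one,
      H.mulVecLin_one, H.mulVecLin_c, H.weight_d] at h_weight_d
    push_cast at h_weight_d
    grind
  · intro τ hτ
    obtain ⟨F, rfl⟩ := RTree.exists_eq_node τ
    rw [RTree.size_node] at hτ
    rw [character_node, character_node, weight_adjoint]
    exact H.weight_stages_eq F (by omega)
  · intro h
    have h_tall := h (RTree.tall 7) (by rw [RTree.size_tall])
    rw [character_tall, character_tall, weight_adjoint, one_eq_comb c d g] at h_tall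
    simp only [Function.iterate_succ_apply', Function.iterate_zero_apply, H.mulVecLin_comb,
      H.mulVecLin_adjoint_comb, H.weight_comb] at h_tall
    grind

end IsEffectivelySymmetric

end Comb

end

/-! ### Necessary relations -/

section

variable {n : ℕ} {Ψ : RKScheme n} {c d g : Fin n → ℝ} {k c₃ c₄ : ℝ}

/-- The relations between the internal weights `c`, `d`, `g` of the tall trees in an explicit
four-stage scheme with abscissae `0`, `k`, `c₃`, `c₄`, assuming that the scheme has order two and
that its elementary weights agree with those of its adjoint on trees with at most six nodes. -/
structure IsSymmetricUpToSix (Ψ : RKScheme n) (k c₃ c₄ : ℝ) (c d g : Fin n → ℝ) : Prop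
    extends TallStages Ψ c d g where
  mulVecLin_mulVecLin_c_mul_c : Ψ.A.mulVecLin (Ψ.A.mulVecLin (c * c)) = k • g
  mulVecLin_c_mul_d : Ψ.A.mulVecLin (c * d) = c₃ • g
  c_mul_g : c * g = c₄ • g
  weight_one : Ψ.weight 1 = 1
  weight_c : Ψ.weight c = 1 / 2
  agreeUpTo_six : AgreeUpTo 6 Ψ.character Ψ.adjoint.character

namespace IsSymmetricUpToSix

theorem weight_stages_eq (H : Ψ.IsSymmetricUpToSix k c₃ c₄ c d g) (F : Forest)
    (hF : (F.map RTree.size).sum ≤ 5) :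
    Ψ.weight (Ψ.stages (forest F)) = Ψ.weight (Ψ.adjoint.stages (forest F)) := by
  have h_node := H.agreeUpTo_six (RTree.node F) (by rw [RTree.size_node]; omega)
  rwa [character_node, character_node, weight_adjoint] at h_node

theorem weight_g (H : Ψ.IsSymmetricUpToSix k c₃ c₄ c d g) :
    Ψ.weight g = Ψ.weight d ^ 2 ∧ Ψ.weight d ^ 2 = Ψ.weight d - 1 / 8 := by
  have h₃ := H.weight_stages_eq {RTree.tall 2} (by simp [RTree.size_tall])
  have h₅ := H.weight_stages_eq {RTree.tall 4} (by simp [RTree.size_tall])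
  simp only [forest_singleton, stages_tall, Function.iterate_succ_apply',
    Function.iterate_zero_apply, mulVecLin_adjoint, map_sub, map_smul, smul_eq_mul,
    H.mulVecLin_one, H.mulVecLin_c, H.mulVecLin_d, H.mulVecLin_g, map_zero, H.weight_one,
    H.weight_c] at h₃ h₅
  constructor <;> linarith

theorem weight_mulVecLin_c_mul_c (H : Ψ.IsSymmetricUpToSix k c₃ c₄ c d g) :
    2 * Ψ.weight (Ψ.A.mulVecLin (c * c)) = Ψ.weight (c * c) + 2 * Ψ.weight d - 1 / 2 := by
  have h := H.weight_stages_eq {RTree.node ({RTree.tall 0} + {RTree.tall 0})}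
    (by simp [RTree.size_tall, RTree.size_node])
  simp only [forest_singleton, forest_add, stages_node, map_mul, stages_tall,
    Function.iterate_succ_apply', Function.iterate_zero_apply, mulVecLin_adjoint, map_sub,
    map_smul, smul_eq_mul, sub_mul, mul_sub, one_smul, one_mul, mul_one, H.mulVecLin_one,
    H.mulVecLin_c, H.weight_one, H.weight_c] at h
  linarith

theorem mul_weight_g (H : Ψ.IsSymmetricUpToSix k c₃ c₄ c d g) :
    k * Ψ.weight g = Ψ.weight (Ψ.A.mulVecLin (c * c)) / 2 - Ψ.weight (c * c) * Ψ.weight d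
      + Ψ.weight g := by
  have h := H.weight_stages_eq
    {RTree.node {RTree.node {RTree.node ({RTree.tall 0} + {RTree.tall 0})}}}
    (by simp [RTree.size_tall, RTree.size_node])
  simp only [forest_singleton, forest_add, stages_node, map_mul, stages_tall,
    Function.iterate_succ_apply', Function.iterate_zero_apply, mulVecLin_adjoint, map_sub,
    map_smul, smul_eq_mul, sub_mul, mul_sub, one_smul, one_mul, mul_one, H.mulVecLin_one,
    H.mulVecLin_c, H.mulVecLin_d, H.mulVecLin_g, H.mulVecLin_mulVecLin_c_mul_c, smul_zero, map_zero,
    H.weight_one, H.weight_c] at h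
  have := H.weight_mulVecLin_c_mul_c
  have := H.weight_g
  grind

theorem weight_c_mul_d (H : Ψ.IsSymmetricUpToSix k c₃ c₄ c d g) :
    2 * Ψ.weight (c * d) = Ψ.weight d + Ψ.weight (c * c) - 1 / 4 := by
  have h := H.weight_stages_eq ({RTree.tall 0} + {RTree.tall 1}) (by simp [RTree.size_tall])
  simp only [forest_singleton, forest_add, map_mul, stages_tall,
    Function.iterate_succ_apply', Function.iterate_zero_apply, mulVecLin_adjoint, map_sub,
    map_smul, smul_eq_mul, sub_mul, mul_sub, one_smul, one_mul, mul_one, mul_smul_comm,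
    H.mulVecLin_one, H.mulVecLin_c, H.weight_one, H.weight_c] at h
  linarith

theorem third_abscissa_mul_weight_g (H : Ψ.IsSymmetricUpToSix k c₃ c₄ c d g) :
    c₃ * Ψ.weight g = Ψ.weight (c * d) / 2 - Ψ.weight d / 2 + 3 / 2 * Ψ.weight g
      - k * Ψ.weight g := by
  have h := H.weight_stages_eq {RTree.node {RTree.node ({RTree.tall 0} + {RTree.tall 1})}}
    (by simp [RTree.size_tall, RTree.size_node])
  simp only [forest_singleton, forest_add, stages_node, map_mul, stages_tall,
    Function.iterate_succ_apply', Function.iterate_zero_apply, mulVecLin_adjoint, map_sub,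
    map_smul, smul_eq_mul, sub_mul, mul_sub, one_smul, one_mul, mul_one, mul_smul_comm,
    H.mulVecLin_one, H.mulVecLin_c, H.mulVecLin_d, H.mulVecLin_g, H.mulVecLin_mulVecLin_c_mul_c,
    H.mulVecLin_c_mul_d, smul_zero, map_zero, H.weight_one, H.weight_c] at h
  have := H.weight_mulVecLin_c_mul_c
  have := H.weight_c_mul_d
  have := H.weight_g
  grind

theorem fourth_abscissa_mul_weight_g (H : Ψ.IsSymmetricUpToSix k c₃ c₄ c d g) :
    (2 * k - 2) * (c₄ * Ψ.weight g) = Ψ.weight (Ψ.A.mulVecLin (c * c)) / 2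
      - Ψ.weight (c * c) / 2 + Ψ.weight (c * c) ^ 2 + Ψ.weight d - Ψ.weight (c * d)
      + (k - 2) * Ψ.weight g := by
  have h := H.weight_stages_eq
    ({RTree.tall 0} + {RTree.node {RTree.node ({RTree.tall 0} + {RTree.tall 0})}})
    (by simp [RTree.size_tall, RTree.size_node])
  simp only [forest_singleton, forest_add, stages_node, map_mul, stages_tall,
    Function.iterate_succ_apply', Function.iterate_zero_apply, mulVecLin_adjoint, map_sub,
    map_smul, smul_eq_mul, sub_mul, mul_sub, one_smul, one_mul, mul_one, mul_smul_comm,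
    H.mulVecLin_one, H.mulVecLin_c, H.mulVecLin_d, H.mulVecLin_mulVecLin_c_mul_c,
    H.c_mul_g, H.weight_one, H.weight_c] at h
  have := H.weight_mulVecLin_c_mul_c
  have := H.weight_g
  grind

section Moments

variable {s : ℝ}

theorem sq_eq_two (H : Ψ.IsSymmetricUpToSix k c₃ c₄ c d g) (hs : Ψ.weight d = (2 - s) / 4) :
    s ^ 2 = 2 := by
  have h := H.weight_g.2
  rw [hs] at h
  linarith

theorem weight_g_eq (H : Ψ.IsSymmetricUpToSix k c₃ c₄ c d g) (hs : Ψ.weight d = (2 - s) / 4) :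
    Ψ.weight g = (3 - 2 * s) / 8 := by
  have h_sq := H.sq_eq_two hs
  rw [H.weight_g.1, hs]
  linarith

theorem weight_g_ne_zero (H : Ψ.IsSymmetricUpToSix k c₃ c₄ c d g)
    (hs : Ψ.weight d = (2 - s) / 4) : Ψ.weight g ≠ 0 := by
  have h_sq := H.sq_eq_two hs
  rw [H.weight_g_eq hs]
  grind

theorem weight_c_mul_c_eq (H : Ψ.IsSymmetricUpToSix k c₃ c₄ c d g)
    (hs : Ψ.weight d = (2 - s) / 4) :
    Ψ.weight (c * c) = 1 - s / 2 + (s - 1) / 2 * k := by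
  have h_sq := H.sq_eq_two hs
  have h_L := H.weight_mulVecLin_c_mul_c
  have h_k := H.mul_weight_g
  rw [hs] at h_L h_k
  rw [H.weight_g_eq hs] at h_k
  grind

theorem weight_mulVecLin_c_mul_c_eq (H : Ψ.IsSymmetricUpToSix k c₃ c₄ c d g)
    (hs : Ψ.weight d = (2 - s) / 4) :
    Ψ.weight (Ψ.A.mulVecLin (c * c)) = 3 / 4 - s / 2 + (s - 1) / 4 * k := by
  have h_L := H.weight_mulVecLin_c_mul_c
  rw [hs, H.weight_c_mul_c_eq hs] at h_L
  linarith

theorem weight_c_mul_d_eq (H : Ψ.IsSymmetricUpToSix k c₃ c₄ c d g)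
    (hs : Ψ.weight d = (2 - s) / 4) :
    Ψ.weight (c * d) = 5 / 8 - 3 / 8 * s + (s - 1) / 4 * k := by
  have h_cd := H.weight_c_mul_d
  rw [hs, H.weight_c_mul_c_eq hs] at h_cd
  linarith

theorem third_abscissa_eq (H : Ψ.IsSymmetricUpToSix k c₃ c₄ c d g)
    (hs : Ψ.weight d = (2 - s) / 4) : c₃ = s * k - s / 2 + 1 := by
  have h_sq := H.sq_eq_two hs
  have h := H.third_abscissa_mul_weight_g
  rw [hs, H.weight_c_mul_d_eq hs, H.weight_g_eq hs] at h
  grind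

theorem fourth_abscissa_eq (H : Ψ.IsSymmetricUpToSix k c₃ c₄ c d g)
    (hs : Ψ.weight d = (2 - s) / 4) (hk : k ≠ 1) : c₄ = k + s / 2 := by
  have h_sq := H.sq_eq_two hs
  have h := H.fourth_abscissa_mul_weight_g
  rw [hs, H.weight_mulVecLin_c_mul_c_eq hs, H.weight_c_mul_c_eq hs, H.weight_c_mul_d_eq hs,
    H.weight_g_eq hs] at h
  refine mul_left_cancel₀ (sub_ne_zero.2 hk) ?_
  grind

end Moments

end IsSymmetricUpToSix

end

section

variable {Ψ : RKScheme 4} {k c₃ c₄ d₃ d₄ g₄ s : ℝ}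

namespace IsExplicit

theorem mulVecLin (hΨ : Ψ.IsExplicit) (v : Fin 4 → ℝ) :
    Ψ.A.mulVecLin v = ![0, Ψ.A 1 0 * v 0, Ψ.A 2 0 * v 0 + Ψ.A 2 1 * v 1,
      Ψ.A 3 0 * v 0 + Ψ.A 3 1 * v 1 + Ψ.A 3 2 * v 2] := by
  have h_zero : ∀ i j : Fin 4, i ≤ j → Ψ.A i j = 0 := hΨ
  ext i
  fin_cases i <;> simp [Matrix.mulVec, dotProduct, Fin.sum_univ_four, h_zero]

theorem tallStages_iff (hΨ : Ψ.IsExplicit) :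
    Ψ.TallStages ![0, k, c₃, c₄] ![0, 0, d₃, d₄] ![0, 0, 0, g₄] ↔
      Ψ.A 1 0 = k ∧ Ψ.A 2 0 + Ψ.A 2 1 = c₃ ∧ Ψ.A 3 0 + Ψ.A 3 1 + Ψ.A 3 2 = c₄ ∧
        Ψ.A 2 1 * k = d₃ ∧ Ψ.A 3 1 * k + Ψ.A 3 2 * c₃ = d₄ ∧ Ψ.A 3 2 * d₃ = g₄ := by
  refine ⟨fun ⟨h_one, hc, hd, _⟩ => ?_, fun ⟨hk, hc₃, hc₄, hd₃, hd₄, hg₄⟩ => ?_⟩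
  · simp only [hΨ.mulVecLin, Matrix.vecCons_inj, Pi.one_apply, Matrix.cons_val, mul_zero, mul_one,
      zero_add, and_true, true_and] at h_one hc hd
    exact ⟨h_one.1, h_one.2.1, h_one.2.2, hc.1, hc.2, hd⟩
  · constructor <;> simp [hΨ.mulVecLin, hk, hc₃, hc₄, hd₃, hd₄, hg₄]

theorem isSymmetricUpToSix (hΨ : Ψ.IsExplicit)
    (T : Ψ.TallStages ![0, k, c₃, c₄] ![0, 0, d₃, d₄] ![0, 0, 0, g₄])
    (h_order : Ψ.character.HasOrder 2) (h : AgreeUpTo 6 Ψ.character Ψ.adjoint.character) :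
    Ψ.IsSymmetricUpToSix k c₃ c₄ ![0, k, c₃, c₄] ![0, 0, d₃, d₄] ![0, 0, 0, g₄] := by
  obtain ⟨-, -, -, hd₃, -, hg₄⟩ := hΨ.tallStages_iff.1 T
  refine ⟨T, ?_, ?_, ?_, (hasOrder_two_iff.1 h_order).1, ?_, h⟩
  · simp only [hΨ.mulVecLin, ← hg₄, ← hd₃]
    ext i
    fin_cases i <;> simp [mul_assoc, mul_comm]
  · simp only [hΨ.mulVecLin, ← hg₄]
    ext i
    fin_cases i <;> simp [mul_assoc, mul_comm]
  · ext i
    fin_cases i <;> simp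
  · rw [← (hasOrder_two_iff.1 h_order).2, T.mulVecLin_one]

theorem ne_zero_of_weight_ne_zero (hΨ : Ψ.IsExplicit)
    (T : Ψ.TallStages ![0, k, c₃, c₄] ![0, 0, d₃, d₄] ![0, 0, 0, g₄])
    (h : Ψ.weight ![0, 0, 0, g₄] ≠ 0) :
    Ψ.b 3 ≠ 0 ∧ Ψ.A 3 2 ≠ 0 ∧ k ≠ 0 ∧ d₃ ≠ 0 ∧ g₄ ≠ 0 := by
  obtain ⟨-, -, -, rfl, -, rfl⟩ := hΨ.tallStages_iff.1 T
  simp only [weight_apply, Fin.sum_univ_four, Matrix.cons_val, mul_zero, zero_add, ne_eq,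
    mul_eq_zero, not_or] at h
  simp [h]

theorem eq_zero_of_weight_eq_zero (hΨ : Ψ.IsExplicit) (hb : Ψ.b 3 ≠ 0) (hA : Ψ.A 3 2 ≠ 0)
    {v : Fin 4 → ℝ} (h₀ : v 0 = 0) (h₁ : v 1 = 0) (h : Ψ.weight v = 0)
    (h_map : Ψ.weight (Ψ.A.mulVecLin v) = 0) : v = 0 := by
  have h₂ : v 2 = 0 := by
    simpa [weight_apply, Fin.sum_univ_four, hΨ.mulVecLin, h₀, h₁, hb, hA] using h_map
  have h₃ : v 3 = 0 := by
    simpa [weight_apply, Fin.sum_univ_four, h₀, h₁, h₂, hb] using h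
  ext i
  fin_cases i <;> assumption

theorem isEffectivelySymmetric (hΨ : Ψ.IsExplicit)
    (H : Ψ.IsSymmetricUpToSix k c₃ c₄ ![0, k, c₃, c₄] ![0, 0, d₃, d₄] ![0, 0, 0, g₄])
    (hs : Ψ.weight ![0, 0, d₃, d₄] = (2 - s) / 4) :
    Ψ.IsEffectivelySymmetric s k ![0, k, c₃, c₄] ![0, 0, d₃, d₄] ![0, 0, 0, g₄] := by
  obtain ⟨hb, hA, -⟩ := hΨ.ne_zero_of_weight_ne_zero H.toTallStages (H.weight_g_ne_zero hs)
  have hsq := H.sq_eq_two hs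
  have h_cc : ![0, k, c₃, c₄] * ![0, k, c₃, c₄] =
      k • ![0, k, c₃, c₄] - (2 * (k - 1)) • ![0, 0, d₃, d₄] := by
    refine sub_eq_zero.1 (hΨ.eq_zero_of_weight_eq_zero hb hA (by simp) (by simp) ?_ ?_)
    · simp only [map_sub, map_smul, smul_eq_mul, H.weight_c_mul_c_eq hs, H.weight_c, hs]
      ring
    · simp only [map_sub, map_smul, smul_eq_mul, H.mulVecLin_c, H.mulVecLin_d,
        H.weight_mulVecLin_c_mul_c_eq hs, hs, H.weight_g_eq hs]
      ring
  have hk : k ≠ 1 := by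
    rintro rfl
    have h₂ : c₃ * c₃ = c₃ := by simpa using congrFun h_cc 2
    rw [H.third_abscissa_eq hs] at h₂
    grind
  refine ⟨H.toTallStages, hsq, hk, h_cc, ?_, H.fourth_abscissa_eq hs hk ▸ H.c_mul_g, H.weight_one,
    H.weight_c, hs, H.weight_g_eq hs⟩
  refine sub_eq_zero.1 (hΨ.eq_zero_of_weight_eq_zero hb hA (by simp) (by simp) ?_ ?_)
  · simp only [map_sub, map_smul, smul_eq_mul, H.weight_c_mul_d_eq hs, hs, H.weight_g_eq hs]
    grind
  · simp only [← H.third_abscissa_eq hs, map_sub, map_smul, H.mulVecLin_c_mul_d,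
      H.mulVecLin_d, H.mulVecLin_g, smul_zero, map_zero, sub_zero, sub_self]

end IsExplicit

theorem IsEES.exists_isEffectivelySymmetric (h : Ψ.IsEES 2 7) :
    ∃ s k c₃ c₄ d₃ d₄ g₄ : ℝ,
      Ψ.IsEffectivelySymmetric s k ![0, k, c₃, c₄] ![0, 0, d₃, d₄] ![0, 0, 0, g₄] := by
  obtain ⟨hΨ, ⟨h_order, -⟩, h_agree, -⟩ := isEES_two_seven_iff.1 h
  have H := hΨ.isSymmetricUpToSix (hΨ.tallStages_iff.2 ⟨rfl, rfl, rfl, rfl, rfl, rfl⟩) h_order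
    h_agree
  exact ⟨_, _, _, _, _, _, _, hΨ.isEffectivelySymmetric H (s := 2 - 4 * Ψ.weight _) (by ring)⟩

end

/-! ### The one-parameter family -/

section

/-- The one-parameter family of explicit four-stage schemes in EES(2,7) of first weight `x`, for
each square root `s` of `2`. -/
noncomputable def eesFamily (s x : ℝ) : RKScheme 4 where
  A := !![0, 0, 0, 0;
    (-2 + s * (1 - 2 * x)) / (4 * (x - 1)), 0, 0, 0;
    (2 * x + s - 2) * (4 * x + s - 2) / (4 * s * (x - 1)) *
      ((2 * x + s) / ((2 * x - 1) * (-2 * x - s + 1))),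
    (-1 + s) / 2 * ((2 * x + s) / ((2 * x - 1) * (-2 * x - s + 1))), 0, 0;
    (-40 * x ^ 4 + (80 - 40 * s) * x ^ 3 - (88 - 60 * s) * x ^ 2
        + (48 - 34 * s) * x + 7 * s - 10) / (2 * (x - 1) * (2 * x + s)) *
      (1 / ((2 * x - 1) * (1 - s - 2 * x) * (2 - s - 2 * x))),
    (2 - s) * x * (x - 1) * (4 * x + s - 2) *
      (1 / ((2 * x - 1) * (1 - s - 2 * x) * (2 - s - 2 * x))),
    (2 - s) * (x - 1) * (2 * x - 1) / ((2 * x + s) * (2 - s - 2 * x)), 0]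
  b := ![x, (2 - s) / 2 - (1 - s) * x, (1 - s) * (x - 1), (2 - s) / 2 - x]

theorem eesFamily_isExplicit (s x : ℝ) : (eesFamily s x).IsExplicit := by
  intro i j hij
  fin_cases i <;> fin_cases j <;> first | rfl | exact absurd hij (by decide)

/-- The values of the parameter for which the denominators in `eesFamily` do not vanish. -/
structure EESParameter (s x : ℝ) : Prop where
  sq_eq_two : s ^ 2 = 2
  ne₁ : x - 1 ≠ 0
  ne₂ : 2 * x - 1 ≠ 0
  ne₃ : 1 - s - 2 * x ≠ 0
  ne₄ : 2 - s - 2 * x ≠ 0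
  ne₅ : 2 * x + s ≠ 0

theorem eesParameter_iff {s x : ℝ} : EESParameter s x ↔ s ^ 2 = 2 ∧
    x ≠ 1 ∧ x ≠ 1 / 2 ∧ x ≠ (1 - s) / 2 ∧ x ≠ (2 - s) / 2 ∧ x ≠ -s / 2 := by
  constructor
  · rintro ⟨hs, h₁, h₂, h₃, h₄, h₅⟩
    grind
  · rintro ⟨hs, h₁, h₂, h₃, h₄, h₅⟩
    constructor <;> grind

/-- The abscissae `A 1` of `eesFamily`. -/
noncomputable def eesAbscissae (s x : ℝ) : Fin 4 → ℝ :=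
  ![0, s * (1 - s - 2 * x) / (4 * (x - 1)), -s * (2 * x + s) / (4 * (x - 1)),
    -(s + 2) / (4 * (x - 1))]

/-- The vector `A² 1` of `eesFamily`. -/
noncomputable def eesSecondStages (s x : ℝ) : Fin 4 → ℝ :=
  ![0, 0, (s - 1) * s * (2 * x + s) / (8 * (x - 1) * (2 * x - 1)), -s / (4 * (2 * x - 1))]

/-- The vector `A³ 1` of `eesFamily`. -/
noncomputable def eesThirdStages (s x : ℝ) : Fin 4 → ℝ :=
  ![0, 0, 0, (3 - 2 * s) / (4 * (2 - s - 2 * x))]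

namespace EESParameter

variable {s x : ℝ}

theorem ne_zero (h : EESParameter s x) : s ≠ 0 := by
  have hs := h.sq_eq_two
  grind

theorem tallStages (h : EESParameter s x) : (eesFamily s x).TallStages
    (eesAbscissae s x) (eesSecondStages s x) (eesThirdStages s x) := by
  have hs₀ := h.ne_zero
  obtain ⟨hs, h₁, h₂, h₃, h₄, h₅⟩ := h
  refine (eesFamily_isExplicit s x).tallStages_iff.2 ⟨?_, ?_, ?_, ?_, ?_, ?_⟩ <;>
    simp only [eesFamily, Matrix.of_apply, Matrix.cons_val]
  · congr 1
    linear_combination hs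
  · rw [show -2 * x - s + 1 = 1 - s - 2 * x by ring]
    field_simp
    clear * - hs
    grind
  · rw [mul_one_div, mul_one_div, div_div,
      div_add_div _ _ (by simp [*]) (by simp [*]), div_add_div _ _ (by simp [*]) (by simp [*]),
      div_eq_div_iff (by simp [*]) (by simp [*])]
    clear * - hs
    grind
  · rw [show -2 * x - s + 1 = 1 - s - 2 * x by ring]
    field_simp
    ring
  · field_simp
    linear_combination (-x) * hs
  · field_simp
    linear_combination (12 - 4 * s) * hs

theorem abscissae_mul_abscissae (h : EESParameter s x) :
    eesAbscissae s x * eesAbscissae s x =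
      eesAbscissae s x 1 • eesAbscissae s x
        - (2 * (eesAbscissae s x 1 - 1)) • eesSecondStages s x := by
  obtain ⟨hs, h₁, h₂, -, -, -⟩ := h
  ext i
  fin_cases i <;>
    simp only [eesAbscissae, eesSecondStages, Fin.zero_eta, Fin.mk_one, Fin.reduceFinMk,
      Pi.mul_apply, Pi.sub_apply, Pi.smul_apply, smul_eq_mul, Matrix.cons_val] <;>
    field_simp <;> clear * - hs <;> grind

theorem abscissae_mul_secondStages (h : EESParameter s x) :
    eesAbscissae s x * eesSecondStages s x =
      (s * eesAbscissae s x 1 - s / 2 + 1) • eesSecondStages s x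
        - ((1 + s) * (2 * eesAbscissae s x 1 - 1)) • eesThirdStages s x := by
  obtain ⟨hs, h₁, h₂, -, h₄, -⟩ := h
  ext i
  fin_cases i <;>
    simp only [eesAbscissae, eesSecondStages, eesThirdStages, Fin.zero_eta, Fin.mk_one,
      Fin.reduceFinMk, Pi.mul_apply, Pi.sub_apply, Pi.smul_apply, smul_eq_mul,
      Matrix.cons_val] <;>
    field_simp <;> clear * - hs <;> grind

theorem abscissae_mul_thirdStages (h : EESParameter s x) :
    eesAbscissae s x * eesThirdStages s x =
      (eesAbscissae s x 1 + s / 2) • eesThirdStages s x := by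
  obtain ⟨hs, h₁, -, -, h₄, -⟩ := h
  ext i
  fin_cases i <;>
    simp only [eesAbscissae, eesThirdStages, Fin.zero_eta, Fin.mk_one, Fin.reduceFinMk,
      Pi.mul_apply, Pi.smul_apply, smul_eq_mul, Matrix.cons_val] <;>
    field_simp <;> grind

theorem abscissa_ne_one (h : EESParameter s x) : eesAbscissae s x 1 ≠ 1 := by
  obtain ⟨hs, h₁, h₂, -, -, -⟩ := h
  intro h
  simp only [eesAbscissae, Matrix.cons_val] at h
  field_simp at h
  grind

theorem weight_eq (h : EESParameter s x) :
    (eesFamily s x).weight 1 = 1 ∧ (eesFamily s x).weight (eesAbscissae s x) = 1 / 2 ∧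
      (eesFamily s x).weight (eesSecondStages s x) = (2 - s) / 4 ∧
      (eesFamily s x).weight (eesThirdStages s x) = (3 - 2 * s) / 8 := by
  obtain ⟨hs, h₁, h₂, -, h₄, -⟩ := h
  rw [mul_comm] at h₂ h₄
  simp only [weight_apply, Fin.sum_univ_four, eesFamily, eesAbscissae, eesSecondStages,
    eesThirdStages, Matrix.cons_val, Pi.one_apply]
  refine ⟨?_, ?_, ?_, ?_⟩ <;> field_simp <;> clear * - hs <;> grind

theorem isEffectivelySymmetric (h : EESParameter s x) :
    (eesFamily s x).IsEffectivelySymmetric s (eesAbscissae s x 1)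
      (eesAbscissae s x) (eesSecondStages s x) (eesThirdStages s x) :=
  have ⟨h_one, hc, hd, hg⟩ := h.weight_eq
  ⟨h.tallStages, h.sq_eq_two, h.abscissa_ne_one, h.abscissae_mul_abscissae,
    h.abscissae_mul_secondStages, h.abscissae_mul_thirdStages, h_one, hc, hd, hg⟩

end EESParameter

theorem TallStages.eq_of_span_eq_top {n : ℕ} {Ψ Φ : RKScheme n} {c d g : Fin n → ℝ}
    (hΨ : Ψ.TallStages c d g) (hΦ : Φ.TallStages c d g)
    (h_span : Submodule.span ℝ {1, c, d, g} = ⊤)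
    (h_weight : ∀ v ∈ ({1, c, d, g} : Set (Fin n → ℝ)), Ψ.weight v = Φ.weight v) : Ψ = Φ := by
  have hA : Ψ.A.mulVecLin = Φ.A.mulVecLin := LinearMap.ext_on h_span (by
    rintro v (rfl | rfl | rfl | rfl)
    · rw [hΨ.mulVecLin_one, hΦ.mulVecLin_one]
    · rw [hΨ.mulVecLin_c, hΦ.mulVecLin_c]
    · rw [hΨ.mulVecLin_d, hΦ.mulVecLin_d]
    · rw [hΨ.mulVecLin_g, hΦ.mulVecLin_g])
  have hb : Ψ.weight = Φ.weight := LinearMap.ext_on h_span h_weight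
  refine RKScheme.ext (Matrix.toLin'.injective hA) (funext fun i => ?_)
  simpa [weight_apply, Pi.single_apply] using LinearMap.congr_fun hb (Pi.single i 1)

theorem span_tallStages_eq_top {k c₃ c₄ d₃ d₄ g₄ : ℝ} (hk : k ≠ 0) (hd₃ : d₃ ≠ 0) (hg₄ : g₄ ≠ 0) :
    Submodule.span ℝ {(1 : Fin 4 → ℝ), ![0, k, c₃, c₄], ![0, 0, d₃, d₄], ![0, 0, 0, g₄]} = ⊤ := by
  refine Submodule.eq_top_iff'.2 fun v => ?_
  simp only [Submodule.mem_span_insert, Submodule.mem_span_singleton]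
  obtain ⟨x₁, hx₁⟩ : ∃ x₁, x₁ * k = v 1 - v 0 := ⟨_, div_mul_cancel₀ _ hk⟩
  obtain ⟨x₂, hx₂⟩ : ∃ x₂, x₂ * d₃ = v 2 - v 0 - x₁ * c₃ := ⟨_, div_mul_cancel₀ _ hd₃⟩
  obtain ⟨x₃, hx₃⟩ : ∃ x₃, x₃ * g₄ = v 3 - v 0 - x₁ * c₄ - x₂ * d₄ := ⟨_, div_mul_cancel₀ _ hg₄⟩
  refine ⟨v 0, _, ⟨x₁, _, ⟨x₂, _, ⟨x₃, rfl⟩, rfl⟩, rfl⟩, ?_⟩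
  ext i
  fin_cases i <;> simp [hx₁, hx₂, hx₃]

theorem eq_iff_of_isExplicit {Ψ Φ : RKScheme 4} (hΦ : Φ.IsExplicit) :
    Ψ = Φ ↔ Ψ.IsExplicit ∧ Ψ.b 0 = Φ.b 0 ∧ Ψ.b 1 = Φ.b 1 ∧ Ψ.b 2 = Φ.b 2 ∧ Ψ.b 3 = Φ.b 3 ∧
      Ψ.A 1 0 = Φ.A 1 0 ∧ Ψ.A 2 0 = Φ.A 2 0 ∧ Ψ.A 2 1 = Φ.A 2 1 ∧
      Ψ.A 3 0 = Φ.A 3 0 ∧ Ψ.A 3 1 = Φ.A 3 1 ∧ Ψ.A 3 2 = Φ.A 3 2 := by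
  refine ⟨?_, fun ⟨hΨ, hb₀, hb₁, hb₂, hb₃, h₁₀, h₂₀, h₂₁, h₃₀, h₃₁, h₃₂⟩ => ?_⟩
  · rintro rfl
    simp [hΦ]
  refine RKScheme.ext (Matrix.ext fun i j => ?_) (funext fun i => ?_)
  · rcases le_or_gt i j with hij | hij
    · rw [hΨ i j hij, hΦ i j hij]
    · fin_cases i <;> fin_cases j <;> first | exact absurd hij (by decide) | assumption
  · fin_cases i <;> assumption

namespace IsEffectivelySymmetric

variable {Ψ Φ : RKScheme 4} {s k c₃ c₄ d₃ d₄ g₄ c₃' c₄' d₃' d₄' g₄' : ℝ}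

theorem ne_zero (H : Ψ.IsEffectivelySymmetric s k ![0, k, c₃, c₄] ![0, 0, d₃, d₄] ![0, 0, 0, g₄])
    (hΨ : Ψ.IsExplicit) : k ≠ 0 ∧ d₃ ≠ 0 ∧ g₄ ≠ 0 := by
  have hs := H.sq_eq_two
  refine (hΨ.ne_zero_of_weight_ne_zero H.toTallStages ?_).2.2
  rw [H.weight_g]
  grind

theorem coordinates (H : Ψ.IsEffectivelySymmetric s k
      ![0, k, c₃, c₄] ![0, 0, d₃, d₄] ![0, 0, 0, g₄]) (hΨ : Ψ.IsExplicit) :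
    c₃ = s * k - s / 2 + 1 ∧ c₄ = k + s / 2 ∧ c₃ * (c₃ - k) = -2 * (k - 1) * d₃ ∧
      c₄ * (c₄ - k) = -2 * (k - 1) * d₄ ∧ (c₄ - c₃) * d₄ = -(1 + s) * (2 * k - 1) * g₄ := by
  obtain ⟨-, hd₃, hg₄⟩ := H.ne_zero hΨ
  have hcc₂ : c₃ * c₃ = k * c₃ - 2 * (k - 1) * d₃ := by simpa using congrFun H.c_mul_c 2
  have hcc₃ : c₄ * c₄ = k * c₄ - 2 * (k - 1) * d₄ := by simpa using congrFun H.c_mul_c 3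
  have hcd₃ : c₄ * d₄ = (s * k - s / 2 + 1) * d₄ - (1 + s) * (2 * k - 1) * g₄ := by
    simpa using congrFun H.c_mul_d 3
  have hc₃ : c₃ = s * k - s / 2 + 1 := by simpa [hd₃] using congrFun H.c_mul_d 2
  have hc₄ : c₄ = k + s / 2 := by simpa [hg₄] using congrFun H.c_mul_g 3
  rw [← hc₃] at hcd₃
  refine ⟨hc₃, hc₄, ?_, ?_, ?_⟩ <;> linarith

theorem abscissae_ne (H : Ψ.IsEffectivelySymmetric s k
      ![0, k, c₃, c₄] ![0, 0, d₃, d₄] ![0, 0, 0, g₄]) (hΨ : Ψ.IsExplicit) :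
    s * k - s / 2 + 1 ≠ 0 ∧ 2 * k + s ≠ 0 ∧ 2 * k - 1 ≠ 0 := by
  have hs := H.sq_eq_two
  obtain ⟨-, hd₃, -⟩ := H.ne_zero hΨ
  obtain ⟨hc₃, hc₄, hd₃_eq, hd₄_eq, hg₄_eq⟩ := H.coordinates hΨ
  have hk := sub_ne_zero.2 H.k_ne_one
  have h_prod : c₃ * (c₃ - k) ≠ 0 := by
    rw [hd₃_eq]
    exact mul_ne_zero (mul_ne_zero (by norm_num) hk) hd₃
  have hks : 2 * k + s ≠ 0 := by
    have h_diff : c₃ - k = (s - 1) / 2 * (2 * k + s) := by grind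
    rw [h_diff] at h_prod
    exact right_ne_zero_of_mul (right_ne_zero_of_mul h_prod)
  refine ⟨hc₃ ▸ left_ne_zero_of_mul h_prod, hks, fun h_half => ?_⟩
  have hd₄ : d₄ = 0 := by
    rw [h_half, mul_zero, zero_mul] at hg₄_eq
    refine (mul_eq_zero.1 hg₄_eq).resolve_left ?_
    grind
  rw [hd₄, mul_zero, hc₄] at hd₄_eq
  grind

theorem eq_of_abscissa_eq
    (H : Ψ.IsEffectivelySymmetric s k ![0, k, c₃, c₄] ![0, 0, d₃, d₄] ![0, 0, 0, g₄])
    (H' : Φ.IsEffectivelySymmetric s k ![0, k, c₃', c₄'] ![0, 0, d₃', d₄'] ![0, 0, 0, g₄'])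
    (hΨ : Ψ.IsExplicit) (hΦ : Φ.IsExplicit) : Ψ = Φ := by
  have hs := H.sq_eq_two
  obtain ⟨hk, hd₃, hg₄⟩ := H.ne_zero hΨ
  obtain ⟨hc₃, hc₄, hd₃_eq, hd₄_eq, hg₄_eq⟩ := H.coordinates hΨ
  obtain ⟨hc₃', hc₄', hd₃_eq', hd₄_eq', hg₄_eq'⟩ := H'.coordinates hΦ
  have hk_one : -2 * (k - 1) ≠ 0 := mul_ne_zero (by norm_num) (sub_ne_zero.2 H.k_ne_one)
  have hk_half : -(1 + s) * (2 * k - 1) ≠ 0 :=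
    mul_ne_zero (by grind) (H.abscissae_ne hΨ).2.2
  obtain rfl : c₃ = c₃' := hc₃.trans hc₃'.symm
  obtain rfl : c₄ = c₄' := hc₄.trans hc₄'.symm
  obtain rfl : d₃ = d₃' := mul_left_cancel₀ hk_one (hd₃_eq.symm.trans hd₃_eq')
  obtain rfl : d₄ = d₄' := mul_left_cancel₀ hk_one (hd₄_eq.symm.trans hd₄_eq')
  obtain rfl : g₄ = g₄' := mul_left_cancel₀ hk_half (hg₄_eq.symm.trans hg₄_eq')
  refine H.toTallStages.eq_of_span_eq_top H'.toTallStages (span_tallStages_eq_top hk hd₃ hg₄) ?_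
  rintro v (rfl | rfl | rfl | rfl)
  · rw [H.weight_one, H'.weight_one]
  · rw [H.weight_c, H'.weight_c]
  · rw [H.weight_d, H'.weight_d]
  · rw [H.weight_g, H'.weight_g]

end IsEffectivelySymmetric

theorem EESParameter.exists_abscissa_eq {s k : ℝ} (hs : s ^ 2 = 2) (hk₀ : k ≠ 0) (hk₁ : k ≠ 1)
    (hc₃ : s * k - s / 2 + 1 ≠ 0) (hks : 2 * k + s ≠ 0) (hk₂ : 2 * k - 1 ≠ 0) :
    ∃ x, EESParameter s x ∧ eesAbscissae s x 1 = k := by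
  -- `x` is obtained by solving `k = s (1 - s - 2 x) / (4 (x - 1))`.
  obtain ⟨x, hx⟩ : ∃ x, x * (2 * (2 * k + s)) = 4 * k - 2 + s :=
    ⟨_, div_mul_cancel₀ _ (mul_ne_zero two_ne_zero hks)⟩
  have h₁ : x - 1 ≠ 0 := by grind
  refine ⟨x, ⟨hs, h₁, by grind, by grind, by grind, by grind⟩, ?_⟩
  simp only [eesAbscissae, Matrix.cons_val]
  rw [div_eq_iff (mul_ne_zero (by norm_num) h₁)]
  grind

theorem IsEES.exists_eq_eesFamily {Ψ : RKScheme 4} (h : Ψ.IsEES 2 7) :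
    ∃ s x, EESParameter s x ∧ Ψ = eesFamily s x := by
  obtain ⟨s, k, c₃, c₄, d₃, d₄, g₄, H⟩ := h.exists_isEffectivelySymmetric
  have hΨ : Ψ.IsExplicit := h.1
  obtain ⟨hc₃, hks, hk₂⟩ := H.abscissae_ne hΨ
  obtain ⟨x, hx, rfl⟩ := EESParameter.exists_abscissa_eq H.sq_eq_two (H.ne_zero hΨ).1 H.k_ne_one
    hc₃ hks hk₂
  exact ⟨s, x, hx, H.eq_of_abscissa_eq hx.isEffectivelySymmetric hΨ (eesFamily_isExplicit s x)⟩

theorem isEES_two_seven_iff_exists_eq_eesFamily {Ψ : RKScheme 4} :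
    Ψ.IsEES 2 7 ↔ ∃ s x, EESParameter s x ∧ Ψ = eesFamily s x := by
  refine ⟨IsEES.exists_eq_eesFamily, ?_⟩
  rintro ⟨s, x, hx, rfl⟩
  exact hx.isEffectivelySymmetric.isEES (eesFamily_isExplicit s x)

end

end RKScheme

theorem mainTheorem8 (Ψ : RKScheme 4) :
    Ψ.IsEES 2 7 ↔
      ∃ s x : ℝ, (s = √2 ∨ s = -√2) ∧
        x ≠ 1 ∧ x ≠ 1 / 2 ∧ x ≠ (1 - s) / 2 ∧ x ≠ (2 - s) / 2 ∧ x ≠ -s / 2 ∧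
        (∀ i j : Fin 4, i ≤ j → Ψ.A i j = 0) ∧
        Ψ.b 0 = x ∧
        Ψ.b 1 = (2 - s) / 2 - (1 - s) * x ∧
        Ψ.b 2 = (1 - s) * (x - 1) ∧
        Ψ.b 3 = (2 - s) / 2 - x ∧
        Ψ.A 1 0 = (-2 + s * (1 - 2 * x)) / (4 * (x - 1)) ∧
        Ψ.A 2 0 = (2 * x + s - 2) * (4 * x + s - 2) / (4 * s * (x - 1)) *
          ((2 * x + s) / ((2 * x - 1) * (-2 * x - s + 1))) ∧
        Ψ.A 2 1 = (-1 + s) / 2 * ((2 * x + s) / ((2 * x - 1) * (-2 * x - s + 1))) ∧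
        Ψ.A 3 0 = (-40 * x ^ 4 + (80 - 40 * s) * x ^ 3 - (88 - 60 * s) * x ^ 2
            + (48 - 34 * s) * x + 7 * s - 10) / (2 * (x - 1) * (2 * x + s)) *
          (1 / ((2 * x - 1) * (1 - s - 2 * x) * (2 - s - 2 * x))) ∧
        Ψ.A 3 1 = (2 - s) * x * (x - 1) * (4 * x + s - 2) *
          (1 / ((2 * x - 1) * (1 - s - 2 * x) * (2 - s - 2 * x))) ∧
        Ψ.A 3 2 = (2 - s) * (x - 1) * (2 * x - 1) / ((2 * x + s) * (2 - s - 2 * x)) := by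
  have hs (s : ℝ) : s = √2 ∨ s = -√2 ↔ s ^ 2 = 2 := by
    rw [← sq_eq_sq_iff_eq_or_eq_neg, Real.sq_sqrt zero_le_two]
  simp only [RKScheme.isEES_two_seven_iff_exists_eq_eesFamily, RKScheme.eesParameter_iff,
    RKScheme.eq_iff_of_isExplicit (RKScheme.eesFamily_isExplicit _ _), hs, and_assoc]
  exact Iff.rfl
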